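/- Setting. Let $A\in\mathbb{R}^{d_x\times d_x}$, $B\in\mathbb{R}^{d_x\times d_u}$ be stabilizable (some $A-BK$ has spectral radius $<1$), let $R_x,R_u\succ 0$, $\ell(x,u)=x^\top R_x x+u^\top R_u u$, and let $\|w_t\|\le 1$ for $1\le t\le T$, with $w_s=0$ for $s\le 0$ and $s>T$, where $T\ge 2$. States evolve as $x_1=0$, $x_{t+1}=Ax_t+Bu_t+w_t$. Norms are Euclidean and operator norms, and $\|x\|_P^2=x^\top P x$. Let $P_\infty\succeq 0$ be the unique positive semidefinite solution of $P=A^\top PA+R_x-A^\top PB(R_u+B^\top PB)^{-1}B^\top PA$, and put $\Sigma_\infty=R_u+B^\top P_\infty B$, $K_\infty=\Sigma_\infty^{-1}B^\top P_\infty A$, $A_{\mathrm{cl},\infty}=A-BK_\infty$. Put $\Psi_\star=\max\{1,\|A\|,\|B\|,\|R_x\|,\|R_u\|\}$, $\beta_\star=\max\{1,\lambda_{\min}^{-1}(R_u),\lambda_{\min}^{-1}(R_x)\}$, $\Gamma_\star=\max\{1,\|P_\infty\|\}$, $\gamma_\infty=\|I-P_\infty^{-1/2}R_xP_\infty^{-1/2}\|^{1/2}$,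 $\kappa_\infty=\|P_\infty^{1/2}\|\|P_\infty^{-1/2}\|$, and let $\kappa_0\ge\kappa_\infty$, $\gamma_\infty\le\gamma_0<1$. Define $\mathbf{Q}^\star_T(x,u;w)=\ell(x,u)$, $\mathbf{V}^\star_T(x;w)=\ell(x,0)$ and, for $t<T$, $\mathbf{Q}^\star_t(x,u;w)=\ell(x,u)+\mathbf{V}^\star_{t+1}(Ax+Bu+w_t;w)$, $\mathbf{V}^\star_t(x;w)=\min_u\mathbf{Q}^\star_t(x,u;w)$. Let $\pi^\star_t(x;w)=\arg\min_u\mathbf{Q}^\star_t(x,u;w)$ and $\mathbf{A}^\star_t(u;x,w)=\mathbf{Q}^\star_t(x,u;w)-\mathbf{Q}^\star_t(x,\pi^\star_t(x;w);w)$. For $M=(M^{[i]})_{i=1}^m$ in $\mathbb{R}^{d_u\times d_x}$ let $q^M(w_{t-1})=\sum_{i=1}^mM^{[i]}w_{t-i}$, and let $\mathcal{M}_0=\{M:\|M^{[i]}\|\le R_\star\gamma_0^{i-1}\ \forall i\le m\}$ with $m=(1-\gamma_0)^{-1}\log((1-\gamma_0)^{-1}T)$ and $R_\star=2\beta_\star\Psi_\star^2\Gamma_\star\kappa_0^2$.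 Let $h=2(1-\gamma_\infty)^{-1}\log(\kappa_\infty^2\beta_\star^2\Psi_\star\Gamma_\star^2T^2)$ ($m$ and $h$ are rounded, up or down, to integers) and $q^\star_{\infty;h}(w_{t:t+h})=\sum_{i=1}^{h+1}\Sigma_\infty^{-1}B^\top(A_{\mathrm{cl},\infty}^\top)^{i-1}P_\infty w_{t+i-1}$. Theorem. There are universal constants $C>0$ and $k\in\mathbb{N}$ such that in this setting, for every policy $\pi_t(x;w)=-K_\infty x-q^{M_t}(w_{t-1})$ with $M_t=M_t(w)\in\mathcal{M}_0$, whose states and inputs are denoted $x^\pi_t,u^\pi_t$, $$\sum_{t=1}^T\Big|\mathbf{A}^\star_t(u^\pi_t;x^\pi_t,w)-\big\|q^{M_t}(w_{t-1})-q^\star_{\infty;h}(w_{t:t+h})\big\|_{\Sigma_\infty}^2\Big|\le C\,\beta_\star^{11}\Psi_\star^{19}\Gamma_\star^{11}\kappa_0^8(1-\gamma_0)^{-4}\,\log^k\!\big(2+\beta_\star\Psi_\star\Gamma_\star\kappa_0(1-\gamma_0)^{-1}\big)\,\log^2T,$$ that is, the left-hand side is $\widetilde{O}\big(\beta_\star^{11}\Psi_\star^{19}\Gamma_\star^{11}\kappa_0^8(1-\gamma_0)^{-4}\log^2T\big)$,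 where $\widetilde{O}$ hides logarithms of the system parameters. -/

import Mathlib

open scoped Matrix Matrix.Norms.L2Operator MatrixOrder

/-!
Throughout, states are vectors in `ℝⁿ` and inputs vectors in `ℝᵈ`. The scoped norm on matrices is
the `ℓ² → ℓ²` operator norm, and the scoped order on matrices is the Loewner order.
-/

/-- The data `(A, B, R_x, R_u)` of an online LQR problem with state dimension `n` and input
dimension `d`. -/
structure LQR (n d : ℕ) where
  /-- state transition matrix -/
  A : Matrix (Fin n) (Fin n) ℝ
  /-- input matrix -/
  B : Matrix (Fin n) (Fin d) ℝ
  /-- state cost -/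
  Rx : Matrix (Fin n) (Fin n) ℝ
  /-- input cost -/
  Ru : Matrix (Fin d) (Fin d) ℝ

/-- The squared weighted norm `‖x‖²_P = ⟨x, P x⟩`. -/
def sqNorm {k : ℕ} (P : Matrix (Fin k) (Fin k) ℝ) (x : Fin k → ℝ) : ℝ :=
  x ⬝ᵥ P *ᵥ x

/-- The minimum eigenvalue of a symmetric matrix. -/
noncomputable def lambdaMin {k : ℕ} (R : Matrix (Fin k) (Fin k) ℝ) : ℝ :=
  sInf (spectrum ℝ R)

namespace LQR

variable {n d : ℕ} (S : LQR n d)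

/-- `(A, B)` is stabilizable: some `A - B K` has spectral radius (the largest modulus of a complex
eigenvalue) less than one. -/
def Stabilizable : Prop :=
  ∃ K : Matrix (Fin d) (Fin n) ℝ,
    spectralRadius ℂ ((S.A - S.B * K).map (algebraMap ℝ ℂ)) < 1

/-- The stage cost `ℓ(x, u) = xᵀ R_x x + uᵀ R_u u`. -/
def cost (x : Fin n → ℝ) (u : Fin d → ℝ) : ℝ :=
  sqNorm S.Rx x + sqNorm S.Ru u

/-! ### Infinite-horizon quantities -/

/-- `P` solves the discrete algebraic Riccati equation. -/
def IsDARE (P : Matrix (Fin n) (Fin n) ℝ) : Prop :=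
  P = S.Aᵀ * P * S.A + S.Rx
    - S.Aᵀ * P * S.B * (S.Ru + S.Bᵀ * P * S.B)⁻¹ * S.Bᵀ * P * S.A

/-- `P_∞`, the positive semidefinite solution of the Riccati equation (it exists and is unique
for a stabilizable system with positive definite costs). -/
noncomputable def Pinf : Matrix (Fin n) (Fin n) ℝ :=
  Classical.epsilon fun P => P.PosSemidef ∧ S.IsDARE P

/-- `Σ_∞ = R_u + Bᵀ P_∞ B`. -/
noncomputable def Sinf : Matrix (Fin d) (Fin d) ℝ :=
  S.Ru + S.Bᵀ * S.Pinf * S.B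

/-- `K_∞ = Σ_∞⁻¹ Bᵀ P_∞ A`. -/
noncomputable def Kinf : Matrix (Fin d) (Fin n) ℝ :=
  S.Sinf⁻¹ * S.Bᵀ * S.Pinf * S.A

/-- `A_{cl,∞} = A - B K_∞`. -/
noncomputable def Acl : Matrix (Fin n) (Fin n) ℝ :=
  S.A - S.B * S.Kinf

/-! ### Problem parameters -/

/-- `Ψ⋆ = max {1, ‖A‖, ‖B‖, ‖R_x‖, ‖R_u‖}`. -/
noncomputable def Psi : ℝ :=
  max 1 (max ‖S.A‖ (max ‖S.B‖ (max ‖S.Rx‖ ‖S.Ru‖)))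

/-- `β⋆ = max {1, λ_min(R_u)⁻¹, λ_min(R_x)⁻¹}`. -/
noncomputable def beta : ℝ :=
  max 1 (max (lambdaMin S.Ru)⁻¹ (lambdaMin S.Rx)⁻¹)

/-- `Γ⋆ = max {1, ‖P_∞‖}`. -/
noncomputable def Gam : ℝ :=
  max 1 ‖S.Pinf‖

/-- `γ_∞ = ‖I - P_∞^{-1/2} R_x P_∞^{-1/2}‖^{1/2}`. -/
noncomputable def gammaInf : ℝ :=
  Real.sqrt ‖1 - (CFC.sqrt S.Pinf)⁻¹ * S.Rx * (CFC.sqrt S.Pinf)⁻¹‖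

/-- `κ_∞ = ‖P_∞^{1/2}‖ ‖P_∞^{-1/2}‖`. -/
noncomputable def kappaInf : ℝ :=
  ‖CFC.sqrt S.Pinf‖ * ‖(CFC.sqrt S.Pinf)⁻¹‖

/-! ### The offline optimal policy and its advantage function -/

/-- The optimal value function with `k` steps to go, that is `V⋆_{T-k}(x; w)`: one has
`V⋆_T(x; w) = ℓ(x, 0)` and `V⋆_t(x; w) = min_u {ℓ(x, u) + V⋆_{t+1}(A x + B u + w_t; w)}` for
`t = T - (k + 1) < T`. -/
noncomputable def valueToGo (T : ℕ) (w : ℕ → Fin n → ℝ) : ℕ → (Fin n → ℝ) → ℝ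
  | 0, x => S.cost x 0
  | k + 1, x =>
      ⨅ u : Fin d → ℝ, (S.cost x u
        + valueToGo T w k (S.A *ᵥ x + S.B *ᵥ u + w (T - (k + 1))))

/-- The optimal Q-function `Q⋆_t(x, u; w)` for the horizon `T`. -/
noncomputable def Qstar (T : ℕ) (w : ℕ → Fin n → ℝ) (t : ℕ) (x : Fin n → ℝ) (u : Fin d → ℝ) : ℝ :=
  if t < T then
    S.cost x u + S.valueToGo T w (T - (t + 1)) (S.A *ᵥ x + S.B *ᵥ u + w t)
  else S.cost x u

/-- The offline optimal policy `π⋆_t(x; w) = argmin_u Q⋆_t(x, u; w)`. -/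
noncomputable def pistar (T : ℕ) (w : ℕ → Fin n → ℝ) (t : ℕ) (x : Fin n → ℝ) : Fin d → ℝ :=
  Classical.epsilon fun u => ∀ v, S.Qstar T w t x u ≤ S.Qstar T w t x v

/-- The advantage `A⋆_t(u; x, w) = Q⋆_t(x, u; w) - Q⋆_t(x, π⋆_t(x; w); w)`. -/
noncomputable def advantage (T : ℕ) (w : ℕ → Fin n → ℝ) (t : ℕ) (u : Fin d → ℝ)
    (x : Fin n → ℝ) : ℝ :=
  S.Qstar T w t x u - S.Qstar T w t x (S.pistar T w t x)

/-! ### Policies and trajectories -/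

/-- The states `x_t` generated by a policy `π_t(x; w)`: `x_1 = 0` and
`x_{t+1} = A x_t + B π_t(x_t; w) + w_t` (time starts at `1`; the index `0` is not used). -/
def state (π : ℕ → (Fin n → ℝ) → (ℕ → Fin n → ℝ) → Fin d → ℝ) (w : ℕ → Fin n → ℝ) :
    ℕ → Fin n → ℝ
  | 0 => 0
  | 1 => 0
  | t + 2 =>
      S.A *ᵥ state π w (t + 1) + S.B *ᵥ π (t + 1) (state π w (t + 1)) w + w (t + 1)

/-- The inputs `u_t = π_t(x_t; w)` generated by a policy. -/
def input (π : ℕ → (Fin n → ℝ) → (ℕ → Fin n → ℝ) → Fin d → ℝ) (w : ℕ → Fin n → ℝ) (t : ℕ) :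
    Fin d → ℝ :=
  π t (S.state π w t) w

end LQR

/-- `w` is a disturbance sequence for the horizon `T`: `‖w_t‖ ≤ 1` in the Euclidean norm for every
`t`, and `w_t = 0` for `t = 0` and for `t > T`. -/
def IsDisturbance {n : ℕ} (T : ℕ) (w : ℕ → Fin n → ℝ) : Prop :=
  (∀ t, ‖WithLp.toLp 2 (w t)‖ ≤ 1) ∧ w 0 = 0 ∧ ∀ t, T < t → w t = 0

/-- `q^M(w_{t-1}) = ∑_{i=1}^m M^{[i]} w_{t-i}`, where `M i` stands for `M^{[i+1]}`. As
`w 0 = 0` for a disturbance sequence, truncated subtraction realises the convention that `w_s = 0`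
for `s ≤ 0`. -/
def dapBias {n d m : ℕ} (M : Fin m → Matrix (Fin d) (Fin n) ℝ) (w : ℕ → Fin n → ℝ) (t : ℕ) :
    Fin d → ℝ :=
  ∑ i : Fin m, M i *ᵥ w (t - (i.val + 1))

/-- The set `𝓜(m, R, γ)` of sequences `M^{[1]}, …, M^{[m]}` with `‖M^{[i]}‖ ≤ R γ^{i-1}`. -/
def dapSet (n d m : ℕ) (R γ : ℝ) : Set (Fin m → Matrix (Fin d) (Fin n) ℝ) :=
  {M | ∀ i, ‖M i‖ ≤ R * γ ^ i.val}

namespace LQR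

variable {n d : ℕ} (S : LQR n d)

/-- The radius `R⋆ = 2 β⋆ Ψ⋆² Γ⋆ κ₀²`. -/
noncomputable def Rstar (κ₀ : ℝ) : ℝ :=
  2 * S.beta * S.Psi ^ 2 * S.Gam * κ₀ ^ 2

/-- The policy `π_t(x; w) = -K_∞ x - q^{M_t}(w_{t-1})` with `M_t = M_t(w)`. -/
noncomputable def dapPolicy {m : ℕ}
    (M : ℕ → (ℕ → Fin n → ℝ) → Fin m → Matrix (Fin d) (Fin n) ℝ) :
    ℕ → (Fin n → ℝ) → (ℕ → Fin n → ℝ) → Fin d → ℝ :=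
  fun t x w => -(S.Kinf *ᵥ x) - dapBias (M t w) w t

/-- `q⋆_{∞;h}(w_{t:t+h}) = ∑_{i=1}^{h+1} Σ_∞⁻¹ Bᵀ (A_{cl,∞}ᵀ)^{i-1} P_∞ w_{t+i-1}`. -/
noncomputable def qInf (h : ℕ) (w : ℕ → Fin n → ℝ) (t : ℕ) : Fin d → ℝ :=
  ∑ i ∈ Finset.range (h + 1), (S.Sinf⁻¹ * S.Bᵀ * S.Aclᵀ ^ i * S.Pinf) *ᵥ w (t + i)

/-- The approximate advantage `‖q^M(w_{t-1}) - q⋆_{∞;h}(w_{t:t+h})‖²_{Σ_∞}`. -/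
noncomputable def approxAdvantage {m : ℕ} (h : ℕ) (M : Fin m → Matrix (Fin d) (Fin n) ℝ)
    (w : ℕ → Fin n → ℝ) (t : ℕ) : ℝ :=
  sqNorm S.Sinf (dapBias M w t - S.qInf h w t)

/-- The prescribed lookahead `2 (1 - γ_∞)⁻¹ log (κ_∞² β⋆² Ψ⋆ Γ⋆² T²)`, a real number. -/
noncomputable def lookahead (T : ℕ) : ℝ :=
  2 * (1 - S.gammaInf)⁻¹
    * Real.log (S.kappaInf ^ 2 * S.beta ^ 2 * S.Psi * S.Gam ^ 2 * (T : ℝ) ^ 2)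

end LQR

/-- The prescribed memory `(1 - γ₀)⁻¹ log ((1 - γ₀)⁻¹ T)` of the disturbance-action policies, a
real number. -/
noncomputable def dapMemory (γ₀ : ℝ) (T : ℕ) : ℝ :=
  (1 - γ₀)⁻¹ * Real.log ((1 - γ₀)⁻¹ * T)

/-! ### Quadratic forms -/

section QuadraticForms

variable {k l : ℕ}

/-! With `k` steps to go the value function is a quadratic with matrix `P_k`, the Riccati iterate
started at `R_x`, plus an affine part driven by future disturbances. Completing the square
(`advantage_eq`) turns the advantage into `‖u + K_k x + offset_k‖²` in the weight `Σ_k = R_u + Bᵀ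
P_k B`. For `u = -K_∞ x - q` it differs from `‖q - q⋆_{∞;h}‖²_{Σ_∞}` in four ways: `Σ_k` against
`Σ_∞`, `K_k` against `K_∞`, the finite-horizon offset against the infinite-horizon one, and the
truncation at lookahead `h`.

The first three errors decay geometrically in the time to go, at a rate governed by `b = β⋆Γ⋆`, for
which `P_∞ ≤ b R_x`. Since `R_x ≤ P_k ≤ P_∞`, each closed loop contracts from the `P_{k+1}`-seminorm
to the `P_k`-seminorm (`sqNorm_closed_le`). Comparing two completions of the square
(`sqNorm_gain_sub`) then gives convergence of both `P_k` and `K_k`. The offsets solve a backward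
recursion through transposed closed loops, so they are measured in dual seminorms (`DualBound`),
where those transposes contract; `wNorm_offset_sub_le` is the outcome.

The truncation error is at most of order `γ_∞^(h+1) ≤ 1/T` per step. Over the horizon the geometric
errors sum to `O(b)` times their size, the truncation errors to `O(1)` times theirs, and the final
time adds one bounded term (`sum_abs_advantage_sub_le`). The resulting bound is free of `T`; `log²
T` enters only through `T ≥ 2`. -/

theorem dotProduct_transpose_mulVec (M : Matrix (Fin k) (Fin l) ℝ) (x : Fin l → ℝ)
    (y : Fin k → ℝ) : x ⬝ᵥ Mᵀ *ᵥ y = (M *ᵥ x) ⬝ᵥ y := by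
  rw [Matrix.dotProduct_mulVec, Matrix.vecMul_transpose]

theorem transpose_mulVec_dotProduct (M : Matrix (Fin k) (Fin l) ℝ) (x : Fin l → ℝ)
    (y : Fin k → ℝ) : (Mᵀ *ᵥ y) ⬝ᵥ x = y ⬝ᵥ (M *ᵥ x) := by
  rw [dotProduct_comm, dotProduct_transpose_mulVec, dotProduct_comm]

theorem dotProduct_mulVec_symm {P : Matrix (Fin k) (Fin k) ℝ} (hP : Pᵀ = P) (x y : Fin k → ℝ) :
    x ⬝ᵥ P *ᵥ y = y ⬝ᵥ P *ᵥ x := by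
  conv_lhs => rw [← hP]
  rw [dotProduct_transpose_mulVec, dotProduct_comm]

theorem sqNorm_add {P : Matrix (Fin k) (Fin k) ℝ} (hP : Pᵀ = P) (x y : Fin k → ℝ) :
    sqNorm P (x + y) = sqNorm P x + 2 * (x ⬝ᵥ P *ᵥ y) + sqNorm P y := by
  simp only [sqNorm, Matrix.mulVec_add, dotProduct_add, add_dotProduct,
    dotProduct_mulVec_symm hP y x]
  ring

theorem sqNorm_smul (P : Matrix (Fin k) (Fin k) ℝ) (c : ℝ) (x : Fin k → ℝ) :
    sqNorm P (c • x) = c ^ 2 * sqNorm P x := by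
  simp only [sqNorm, Matrix.mulVec_smul, dotProduct_smul, smul_dotProduct, smul_eq_mul]
  ring

theorem sqNorm_neg (P : Matrix (Fin k) (Fin k) ℝ) (x : Fin k → ℝ) :
    sqNorm P (-x) = sqNorm P x := by
  simp [sqNorm, Matrix.mulVec_neg]

@[simp] theorem sqNorm_zero (P : Matrix (Fin k) (Fin k) ℝ) : sqNorm P 0 = 0 := by
  simp [sqNorm]

theorem sqNorm_matrix_add (P Q : Matrix (Fin k) (Fin k) ℝ) (x : Fin k → ℝ) :
    sqNorm (P + Q) x = sqNorm P x + sqNorm Q x := by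
  simp [sqNorm, Matrix.add_mulVec]

theorem sqNorm_matrix_sub (P Q : Matrix (Fin k) (Fin k) ℝ) (x : Fin k → ℝ) :
    sqNorm (P - Q) x = sqNorm P x - sqNorm Q x := by
  simp [sqNorm, Matrix.sub_mulVec]

theorem sqNorm_congr (P : Matrix (Fin k) (Fin k) ℝ) (M : Matrix (Fin k) (Fin l) ℝ)
    (x : Fin l → ℝ) : sqNorm (Mᵀ * P * M) x = sqNorm P (M *ᵥ x) := by
  simp only [sqNorm, ← Matrix.mulVec_mulVec, dotProduct_transpose_mulVec]

theorem Matrix.PosSemidef.transpose_eq {P : Matrix (Fin k) (Fin k) ℝ} (hP : P.PosSemidef) :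
    Pᵀ = P := by
  simpa using hP.isHermitian.eq

theorem Matrix.PosSemidef.sqNorm_nonneg {P : Matrix (Fin k) (Fin k) ℝ} (hP : P.PosSemidef)
    (x : Fin k → ℝ) : 0 ≤ sqNorm P x := by
  simpa [sqNorm] using hP.dotProduct_mulVec_nonneg x

theorem posSemidef_of_sqNorm_nonneg {P : Matrix (Fin k) (Fin k) ℝ} (hP : Pᵀ = P)
    (h : ∀ x, 0 ≤ sqNorm P x) : P.PosSemidef :=
  .of_dotProduct_mulVec_nonneg (by simpa [Matrix.IsHermitian] using hP)
    fun x => by simpa [sqNorm] using h x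

/-- The Cauchy-Schwarz inequality for a positive semidefinite form. -/
theorem Matrix.PosSemidef.dotProduct_sq_le {P : Matrix (Fin k) (Fin k) ℝ} (hP : P.PosSemidef)
    (x y : Fin k → ℝ) : (x ⬝ᵥ P *ᵥ y) ^ 2 ≤ sqNorm P x * sqNorm P y := by
  have key : ∀ c : ℝ, 0 ≤ sqNorm P y * (c * c) + 2 * (x ⬝ᵥ P *ᵥ y) * c + sqNorm P x := by
    intro c
    have h := hP.sqNorm_nonneg (x + c • y)
    rw [sqNorm_add hP.transpose_eq, sqNorm_smul, Matrix.mulVec_smul, dotProduct_smul,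
      smul_eq_mul] at h
    nlinarith
  have h := discrim_le_zero key
  rw [discrim] at h
  nlinarith

/-- The weighted seminorm `‖x‖_P = √⟨x, P x⟩`. -/
noncomputable def wNorm (P : Matrix (Fin k) (Fin k) ℝ) (x : Fin k → ℝ) : ℝ :=
  √(sqNorm P x)

theorem wNorm_nonneg (P : Matrix (Fin k) (Fin k) ℝ) (x : Fin k → ℝ) : 0 ≤ wNorm P x :=
  Real.sqrt_nonneg _

theorem wNorm_neg (P : Matrix (Fin k) (Fin k) ℝ) (x : Fin k → ℝ) : wNorm P (-x) = wNorm P x := by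
  rw [wNorm, sqNorm_neg, wNorm]

theorem Matrix.PosSemidef.wNorm_sq {P : Matrix (Fin k) (Fin k) ℝ} (hP : P.PosSemidef)
    (x : Fin k → ℝ) : wNorm P x ^ 2 = sqNorm P x :=
  Real.sq_sqrt (hP.sqNorm_nonneg x)

theorem wNorm_le_mul {P : Matrix (Fin k) (Fin k) ℝ} {Q : Matrix (Fin l) (Fin l) ℝ} {c : ℝ}
    (hc : 0 ≤ c) {x : Fin k → ℝ} {y : Fin l → ℝ} (h : sqNorm P x ≤ c ^ 2 * sqNorm Q y) :
    wNorm P x ≤ c * wNorm Q y := by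
  calc wNorm P x ≤ √(c ^ 2 * sqNorm Q y) := Real.sqrt_le_sqrt h
    _ = c * wNorm Q y := by rw [Real.sqrt_mul (sq_nonneg c), Real.sqrt_sq hc, wNorm]

theorem wNorm_mono {P : Matrix (Fin k) (Fin k) ℝ} {Q : Matrix (Fin l) (Fin l) ℝ}
    {x : Fin k → ℝ} {y : Fin l → ℝ} (h : sqNorm P x ≤ sqNorm Q y) : wNorm P x ≤ wNorm Q y :=
  Real.sqrt_le_sqrt h

theorem Matrix.PosSemidef.abs_dotProduct_le {P : Matrix (Fin k) (Fin k) ℝ} (hP : P.PosSemidef)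
    (x y : Fin k → ℝ) : |x ⬝ᵥ P *ᵥ y| ≤ wNorm P x * wNorm P y := by
  refine abs_le_of_sq_le_sq ?_ (mul_nonneg (wNorm_nonneg _ _) (wNorm_nonneg _ _))
  rw [mul_pow, hP.wNorm_sq, hP.wNorm_sq]
  exact hP.dotProduct_sq_le x y

theorem Matrix.PosSemidef.wNorm_add_le {P : Matrix (Fin k) (Fin k) ℝ} (hP : P.PosSemidef)
    (x y : Fin k → ℝ) : wNorm P (x + y) ≤ wNorm P x + wNorm P y := by
  refine le_of_sq_le_sq ?_ (add_nonneg (wNorm_nonneg _ _) (wNorm_nonneg _ _))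
  rw [hP.wNorm_sq, sqNorm_add hP.transpose_eq, add_sq, hP.wNorm_sq, hP.wNorm_sq]
  linarith [le_of_abs_le (hP.abs_dotProduct_le x y)]

theorem Matrix.PosSemidef.wNorm_sub_le {P : Matrix (Fin k) (Fin k) ℝ} (hP : P.PosSemidef)
    (x y : Fin k → ℝ) : wNorm P (x - y) ≤ wNorm P x + wNorm P y := by
  rw [sub_eq_add_neg, ← wNorm_neg P y]
  exact hP.wNorm_add_le x (-y)

/-- A vector whose squared norm is dominated by `c` times its norm has norm at most `c`. -/
theorem Matrix.PosSemidef.wNorm_le_of_sqNorm_le {P : Matrix (Fin k) (Fin k) ℝ}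
    (hP : P.PosSemidef) {c : ℝ} (hc : 0 ≤ c) {x : Fin k → ℝ} (h : sqNorm P x ≤ c * wNorm P x) :
    wNorm P x ≤ c := by
  rw [← hP.wNorm_sq] at h
  by_contra! hlt
  nlinarith

theorem dotProduct_self_eq_norm_sq (x : Fin k → ℝ) : x ⬝ᵥ x = ‖WithLp.toLp 2 x‖ ^ 2 := by
  rw [EuclideanSpace.norm_sq_eq]
  simp [dotProduct, sq]

theorem norm_toLp_mulVec_le (M : Matrix (Fin k) (Fin l) ℝ) (x : Fin l → ℝ) :
    ‖WithLp.toLp 2 (M *ᵥ x)‖ ≤ ‖M‖ * ‖WithLp.toLp 2 x‖ :=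
  M.l2_opNorm_mulVec (WithLp.toLp 2 x)

theorem abs_dotProduct_le_norm (x y : Fin k → ℝ) :
    |x ⬝ᵥ y| ≤ ‖WithLp.toLp 2 x‖ * ‖WithLp.toLp 2 y‖ := by
  have h := abs_real_inner_le_norm (WithLp.toLp 2 y) (WithLp.toLp 2 x)
  rw [mul_comm]
  simpa [EuclideanSpace.inner_eq_star_dotProduct] using h

theorem sqNorm_le_norm (P : Matrix (Fin k) (Fin k) ℝ) (x : Fin k → ℝ) :
    sqNorm P x ≤ ‖P‖ * ‖WithLp.toLp 2 x‖ ^ 2 := by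
  have h := le_of_abs_le (abs_dotProduct_le_norm x (P *ᵥ x))
  have h' := norm_toLp_mulVec_le P x
  rw [sqNorm]
  nlinarith [norm_nonneg (WithLp.toLp 2 x)]

end QuadraticForms

/-! ### The Riccati map -/

namespace LQR

variable {n d : ℕ} (S : LQR n d)

/-- The Hessian `R_u + Bᵀ P B` of the one-step problem with terminal cost `P`. -/
noncomputable def hess (P : Matrix (Fin n) (Fin n) ℝ) : Matrix (Fin d) (Fin d) ℝ :=
  S.Ru + S.Bᵀ * P * S.B

/-- The optimal gain of the one-step problem with terminal cost `P`. -/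
noncomputable def gain (P : Matrix (Fin n) (Fin n) ℝ) : Matrix (Fin d) (Fin n) ℝ :=
  (S.hess P)⁻¹ * S.Bᵀ * P * S.A

/-- The closed-loop matrix of the gain for the terminal cost `P`. -/
noncomputable def closed (P : Matrix (Fin n) (Fin n) ℝ) : Matrix (Fin n) (Fin n) ℝ :=
  S.A - S.B * S.gain P

/-- The Riccati map. -/
noncomputable def ricc (P : Matrix (Fin n) (Fin n) ℝ) : Matrix (Fin n) (Fin n) ℝ :=
  S.Aᵀ * P * S.A + S.Rx
    - S.Aᵀ * P * S.B * (S.Ru + S.Bᵀ * P * S.B)⁻¹ * S.Bᵀ * P * S.A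

variable {S} {P : Matrix (Fin n) (Fin n) ℝ}

theorem sqNorm_hess (P : Matrix (Fin n) (Fin n) ℝ) (u : Fin d → ℝ) :
    sqNorm (S.hess P) u = sqNorm S.Ru u + sqNorm P (S.B *ᵥ u) := by
  rw [hess, sqNorm_matrix_add, sqNorm_congr]

theorem hess_posDef (hRu : S.Ru.PosDef) (hP : P.PosSemidef) : (S.hess P).PosDef := by
  refine hRu.add_posSemidef ?_
  simpa using hP.conjTranspose_mul_mul_same S.B

theorem hess_mulVec_inv (hRu : S.Ru.PosDef) (hP : P.PosSemidef) (v : Fin d → ℝ) :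
    S.hess P *ᵥ (S.hess P)⁻¹ *ᵥ v = v := by
  rw [Matrix.mulVec_mulVec, Matrix.mul_nonsing_inv _ (hess_posDef hRu hP).det_pos.ne'.isUnit,
    Matrix.one_mulVec]

/-- The first-order condition of the one-step problem, through which later identities avoid the
explicit inverse. -/
theorem hess_mulVec_gain (hRu : S.Ru.PosDef) (hP : P.PosSemidef) (x : Fin n → ℝ) :
    S.hess P *ᵥ S.gain P *ᵥ x = S.Bᵀ *ᵥ P *ᵥ S.A *ᵥ x := by
  rw [gain, ← Matrix.mulVec_mulVec, ← Matrix.mulVec_mulVec, ← Matrix.mulVec_mulVec,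
    hess_mulVec_inv hRu hP]

theorem closed_mulVec (P : Matrix (Fin n) (Fin n) ℝ) (x : Fin n → ℝ) :
    S.closed P *ᵥ x = S.A *ᵥ x + S.B *ᵥ (-(S.gain P *ᵥ x)) := by
  rw [closed, Matrix.sub_mulVec, ← Matrix.mulVec_mulVec, Matrix.mulVec_neg, sub_eq_add_neg]

theorem sqNorm_ricc (hRu : S.Ru.PosDef) (hP : P.PosSemidef) (x : Fin n → ℝ) :
    sqNorm (S.ricc P) x
      = sqNorm S.Rx x + sqNorm P (S.A *ᵥ x) - sqNorm (S.hess P) (S.gain P *ᵥ x) := by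
  rw [ricc, sqNorm_matrix_sub, sqNorm_matrix_add, sqNorm_congr, add_comm (sqNorm P _)]
  congr 1
  rw [sqNorm, sqNorm, hess_mulVec_gain hRu hP, dotProduct_transpose_mulVec,
    dotProduct_mulVec_symm hP.transpose_eq]
  simp only [gain, hess, ← Matrix.mulVec_mulVec, dotProduct_transpose_mulVec]

/-- Completion of the square in the one-step problem. -/
theorem cost_add_sqNorm (hRu : S.Ru.PosDef) (hP : P.PosSemidef) (x : Fin n → ℝ)
    (u : Fin d → ℝ) :
    S.cost x u + sqNorm P (S.A *ᵥ x + S.B *ᵥ u)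
      = sqNorm (S.ricc P) x + sqNorm (S.hess P) (u + S.gain P *ᵥ x) := by
  rw [sqNorm_ricc hRu hP, sqNorm_add hP.transpose_eq,
    sqNorm_add (hess_posDef hRu hP).posSemidef.transpose_eq, hess_mulVec_gain hRu hP, cost,
    dotProduct_transpose_mulVec, sqNorm_hess P u, dotProduct_mulVec_symm hP.transpose_eq]
  ring

theorem cost_add_sqNorm_closed (hRu : S.Ru.PosDef) (hP : P.PosSemidef) (x : Fin n → ℝ) :
    sqNorm S.Rx x + sqNorm S.Ru (S.gain P *ᵥ x) + sqNorm P (S.closed P *ᵥ x)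
      = sqNorm (S.ricc P) x := by
  have h := cost_add_sqNorm hRu hP x (-(S.gain P *ᵥ x))
  rw [closed_mulVec]
  simpa [cost, sqNorm_neg] using h

theorem sqNorm_ricc_le (hRu : S.Ru.PosDef) (hP : P.PosSemidef) (x : Fin n → ℝ)
    (u : Fin d → ℝ) :
    sqNorm (S.ricc P) x ≤ S.cost x u + sqNorm P (S.A *ᵥ x + S.B *ᵥ u) := by
  rw [cost_add_sqNorm hRu hP]
  linarith [(hess_posDef hRu hP).posSemidef.sqNorm_nonneg (u + S.gain P *ᵥ x)]

theorem ricc_transpose (hRx : S.Rx.PosDef) (hRu : S.Ru.PosDef) (hP : P.PosSemidef) :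
    (S.ricc P)ᵀ = S.ricc P := by
  have h1 : (S.Ru + S.Bᵀ * P * S.B)ᵀ = S.Ru + S.Bᵀ * P * S.B :=
    (hess_posDef hRu hP).posSemidef.transpose_eq
  simp only [ricc, Matrix.transpose_sub, Matrix.transpose_add, Matrix.transpose_mul,
    Matrix.transpose_transpose, hP.transpose_eq, hRx.posSemidef.transpose_eq,
    Matrix.transpose_nonsing_inv, hRu.posSemidef.transpose_eq, Matrix.mul_assoc]

theorem sqNorm_Rx_le_ricc (hRu : S.Ru.PosDef) (hP : P.PosSemidef) (x : Fin n → ℝ) :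
    sqNorm S.Rx x ≤ sqNorm (S.ricc P) x := by
  rw [← cost_add_sqNorm_closed hRu hP]
  linarith [hRu.posSemidef.sqNorm_nonneg (S.gain P *ᵥ x),
    hP.sqNorm_nonneg (S.closed P *ᵥ x)]

theorem ricc_posSemidef (hRx : S.Rx.PosDef) (hRu : S.Ru.PosDef) (hP : P.PosSemidef) :
    (S.ricc P).PosSemidef :=
  posSemidef_of_sqNorm_nonneg (ricc_transpose hRx hRu hP) fun x =>
    (hRx.posSemidef.sqNorm_nonneg x).trans (sqNorm_Rx_le_ricc hRu hP x)

/-- The value for `P` is at most the cost of the input that is optimal for `Q`, and that cost grows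
with the terminal form. -/
theorem sqNorm_ricc_mono (hRu : S.Ru.PosDef) {Q : Matrix (Fin n) (Fin n) ℝ}
    (hP : P.PosSemidef) (hQ : Q.PosSemidef) (h : ∀ x, sqNorm P x ≤ sqNorm Q x)
    (x : Fin n → ℝ) : sqNorm (S.ricc P) x ≤ sqNorm (S.ricc Q) x := by
  refine (sqNorm_ricc_le hRu hP x (-(S.gain Q *ᵥ x))).trans ?_
  rw [← cost_add_sqNorm_closed hRu hQ, ← closed_mulVec, cost, sqNorm_neg]
  linarith [h (S.closed Q *ᵥ x)]

variable (S) in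
/-- The cost-to-go matrix of the finite-horizon problem with `k` steps to go. -/
noncomputable def costToGo : ℕ → Matrix (Fin n) (Fin n) ℝ
  | 0 => S.Rx
  | k + 1 => S.ricc (costToGo k)

theorem costToGo_posSemidef (hRx : S.Rx.PosDef) (hRu : S.Ru.PosDef) (k : ℕ) :
    (S.costToGo k).PosSemidef := by
  induction k with
  | zero => exact hRx.posSemidef
  | succ k ih => exact ricc_posSemidef hRx hRu ih

theorem sqNorm_costToGo_mono (hRx : S.Rx.PosDef) (hRu : S.Ru.PosDef) (x : Fin n → ℝ) :
    Monotone fun k => sqNorm (S.costToGo k) x := by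
  refine monotone_nat_of_le_succ fun k => ?_
  induction k generalizing x with
  | zero => exact sqNorm_Rx_le_ricc hRu hRx.posSemidef x
  | succ k ih =>
    exact sqNorm_ricc_mono hRu (costToGo_posSemidef hRx hRu k) (costToGo_posSemidef hRx hRu _) ih x

end LQR

/-! ### Existence of a solution of the Riccati equation -/

theorem norm_toLp_complex {k : ℕ} (x : Fin k → ℝ) :
    ‖WithLp.toLp 2 (fun i => (x i : ℂ))‖ = ‖WithLp.toLp 2 x‖ := by
  simp [EuclideanSpace.norm_eq]

theorem norm_toLp_mulVec_le_complex {k : ℕ} (M : Matrix (Fin k) (Fin k) ℝ) (x : Fin k → ℝ) :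
    ‖WithLp.toLp 2 (M *ᵥ x)‖ ≤ ‖M.map (algebraMap ℝ ℂ)‖ * ‖WithLp.toLp 2 x‖ := by
  have h := (M.map (algebraMap ℝ ℂ)).l2_opNorm_mulVec (WithLp.toLp 2 (fun i => (x i : ℂ)))
  rw [norm_toLp_complex] at h
  refine le_trans (le_of_eq ?_) h
  rw [← norm_toLp_complex]
  congr 2
  ext i
  simp [Matrix.mulVec, dotProduct]

open Filter in
/-- The powers of a matrix of spectral radius less than one have summable squared norms along
every vector. -/
theorem summable_norm_sq_pow_mulVec {k : ℕ} {M : Matrix (Fin k) (Fin k) ℝ}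
    (hM : spectralRadius ℂ (M.map (algebraMap ℝ ℂ)) < 1) (x : Fin k → ℝ) :
    Summable fun j : ℕ => ‖WithLp.toLp 2 (M ^ j *ᵥ x)‖ ^ 2 := by
  obtain ⟨r, hr, hr1⟩ := ENNReal.lt_iff_exists_nnreal_btwn.1 hM
  have hr1 : r < 1 := by exact_mod_cast hr1
  -- Gelfand's formula: the `j`-th root of the norm of the `j`-th power is eventually below `r < 1`.
  have hlim := (spectrum.pow_nnnorm_pow_one_div_tendsto_nhds_spectralRadius
    (M.map (algebraMap ℝ ℂ))).eventually_lt_const hr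
  have hbound : ∀ᶠ j : ℕ in atTop, ‖M.map (algebraMap ℝ ℂ) ^ j‖ ≤ (r : ℝ) ^ j := by
    filter_upwards [hlim, eventually_gt_atTop 0] with j hj hj0
    have hj0' : (0 : ℝ) < j := by exact_mod_cast hj0
    have h := ENNReal.rpow_le_rpow hj.le hj0'.le
    rw [← ENNReal.rpow_mul, one_div, inv_mul_cancel₀ hj0'.ne', ENNReal.rpow_one,
      ENNReal.rpow_natCast] at h
    exact_mod_cast h
  have hr2 : (r : ℝ) ^ 2 < 1 := by
    have : (r : ℝ) < 1 := by exact_mod_cast hr1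
    nlinarith [r.coe_nonneg]
  refine Summable.of_norm_bounded_eventually_nat
    (g := fun j => ((r : ℝ) ^ 2) ^ j * ‖WithLp.toLp 2 x‖ ^ 2)
    ((summable_geometric_of_lt_one (sq_nonneg _) hr2).mul_right _) ?_
  filter_upwards [hbound] with j hj
  have h1 := norm_toLp_mulVec_le_complex (M ^ j) x
  have h2 : (M ^ j).map (algebraMap ℝ ℂ) = M.map (algebraMap ℝ ℂ) ^ j :=
    map_pow ((algebraMap ℝ ℂ).mapMatrix) M j
  rw [h2] at h1
  rw [Real.norm_of_nonneg (sq_nonneg _), ← pow_mul, mul_comm 2 j, pow_mul, ← mul_pow]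
  gcongr
  exact h1.trans (by gcongr)

namespace LQR

open Filter Topology

variable {n d : ℕ} {S : LQR n d}

/-- Stabilizability bounds the finite-horizon costs uniformly in the horizon. -/
theorem exists_sqNorm_costToGo_le (hRx : S.Rx.PosDef) (hRu : S.Ru.PosDef)
    (hS : S.Stabilizable) (x : Fin n → ℝ) : ∃ c, ∀ k, sqNorm (S.costToGo k) x ≤ c := by
  obtain ⟨K, hK⟩ := hS
  have hcost : ∀ y, S.cost y (-(K *ᵥ y)) ≤ ‖S.Rx + Kᵀ * S.Ru * K‖ * ‖WithLp.toLp 2 y‖ ^ 2 := by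
    intro y
    refine le_trans (le_of_eq ?_) (sqNorm_le_norm _ y)
    rw [cost, sqNorm_neg, sqNorm_matrix_add, sqNorm_congr]
  have hcost0 : ∀ y u, 0 ≤ S.cost y u := fun y u =>
    add_nonneg (hRx.posSemidef.sqNorm_nonneg y) (hRu.posSemidef.sqNorm_nonneg u)
  set F := S.A - S.B * K with hF
  -- The running costs of the stabilizing feedback from `y`. Their total satisfies the Bellman
  -- recursion of a fixed policy, so it dominates every optimal finite-horizon cost by induction.
  let a : (Fin n → ℝ) → ℕ → ℝ := fun y j => S.cost (F ^ j *ᵥ y) (-(K *ᵥ F ^ j *ᵥ y))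
  have hsum : ∀ y, Summable (a y) := fun y =>
    Summable.of_nonneg_of_le (fun j => hcost0 _ _) (fun j => hcost _)
      ((summable_norm_sq_pow_mulVec hK y).mul_left _)
  have hstep : ∀ y, ∑' j, a y j = a y 0 + ∑' j, a (F *ᵥ y) j := by
    intro y
    rw [(hsum y).tsum_eq_zero_add]
    simp only [a, pow_succ, ← Matrix.mulVec_mulVec]
  refine ⟨∑' j, a x j, fun k => ?_⟩
  induction k generalizing x with
  | zero =>
    refine le_trans ?_ ((hsum x).le_tsum 0 fun j _ => hcost0 _ _)
    simpa [a, cost, costToGo] using hRu.posSemidef.sqNorm_nonneg _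
  | succ k ih =>
    rw [hstep]
    refine (sqNorm_ricc_le hRu (costToGo_posSemidef hRx hRu k) x (-(K *ᵥ x))).trans ?_
    have h : S.A *ᵥ x + S.B *ᵥ (-(K *ᵥ x)) = F *ᵥ x := by
      rw [hF, Matrix.sub_mulVec, ← Matrix.mulVec_mulVec, Matrix.mulVec_neg, sub_eq_add_neg]
    rw [h]
    simpa [a] using ih (F *ᵥ x)

theorem continuousAt_ricc (hRu : S.Ru.PosDef) {P : Matrix (Fin n) (Fin n) ℝ}
    (hP : P.PosSemidef) : ContinuousAt S.ricc P := by
  have hinv : ContinuousAt (fun P => (S.Ru + S.Bᵀ * P * S.B)⁻¹) P := by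
    refine ContinuousAt.comp (g := Inv.inv) (f := fun P => S.Ru + S.Bᵀ * P * S.B)
      (continuousAt_matrix_inv _ ?_) (by fun_prop)
    have h : IsUnit (S.Ru + S.Bᵀ * P * S.B).det := (hess_posDef hRu hP).det_pos.ne'.isUnit
    simpa using NormedRing.inverse_continuousAt h.unit
  unfold ricc
  fun_prop

theorem exists_isDARE (hRx : S.Rx.PosDef) (hRu : S.Ru.PosDef) (hS : S.Stabilizable) :
    ∃ P : Matrix (Fin n) (Fin n) ℝ, P.PosSemidef ∧ S.IsDARE P := by
  have hlim : ∀ x, ∃ c, Tendsto (fun k => sqNorm (S.costToGo k) x) atTop (𝓝 c) := by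
    intro x
    obtain ⟨c, hc⟩ := exists_sqNorm_costToGo_le hRx hRu hS x
    exact ⟨_, tendsto_atTop_ciSup (sqNorm_costToGo_mono hRx hRu x)
      ⟨c, by rintro _ ⟨k, rfl⟩; exact hc k⟩⟩
  choose q hq using hlim
  -- Only the values of the quadratic forms are known to converge; polarization recovers the matrix
  -- entries of the limit.
  let P : Matrix (Fin n) (Fin n) ℝ := fun i j =>
    (q (Pi.single i 1 + Pi.single j 1) - q (Pi.single i 1) - q (Pi.single j 1)) / 2
  have hP : Tendsto S.costToGo atTop (𝓝 P) := by
    refine tendsto_pi_nhds.2 fun i => tendsto_pi_nhds.2 fun j => ?_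
    refine ((((hq (Pi.single i 1 + Pi.single j 1)).sub (hq (Pi.single i 1))).sub
      (hq (Pi.single j 1))).div_const 2).congr fun k => ?_
    rw [sqNorm_add (costToGo_posSemidef hRx hRu k).transpose_eq]
    simp only [Matrix.mulVec_single_one, single_one_dotProduct, Matrix.col_apply]
    ring
  have hPT : Pᵀ = P := by
    ext i j
    change P j i = P i j
    simp only [P, add_comm (Pi.single j (1 : ℝ) : Fin n → ℝ)]
    ring
  have hsq : ∀ x, Tendsto (fun k => sqNorm (S.costToGo k) x) atTop (𝓝 (sqNorm P x)) := by
    intro x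
    have : Continuous fun Q : Matrix (Fin n) (Fin n) ℝ => sqNorm Q x := by
      unfold sqNorm
      fun_prop
    exact (this.tendsto P).comp hP
  have hPpos : P.PosSemidef := posSemidef_of_sqNorm_nonneg hPT fun x =>
    ge_of_tendsto' (hsq x) fun k => (costToGo_posSemidef hRx hRu k).sqNorm_nonneg x
  refine ⟨P, hPpos, ?_⟩
  exact tendsto_nhds_unique (hP.comp (tendsto_add_atTop_nat 1))
    ((continuousAt_ricc hRu hPpos).tendsto.comp hP)

/-- These two properties are all that is needed of `P_∞`; uniqueness plays no role. -/
theorem Pinf_spec (hRx : S.Rx.PosDef) (hRu : S.Ru.PosDef) (hS : S.Stabilizable) :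
    S.Pinf.PosSemidef ∧ S.ricc S.Pinf = S.Pinf := by
  obtain ⟨h1, h2⟩ := Classical.epsilon_spec (exists_isDARE hRx hRu hS)
  exact ⟨h1, Eq.symm h2⟩

end LQR

/-! ### Convergence of the Riccati iteration -/

/-- The linear form `x ↦ ⟨v, x⟩` is bounded by `c ‖x‖_P`. -/
def DualBound {k : ℕ} (P : Matrix (Fin k) (Fin k) ℝ) (c : ℝ) (v : Fin k → ℝ) : Prop :=
  ∀ x, |v ⬝ᵥ x| ≤ c * wNorm P x

theorem DualBound.mono {k : ℕ} {P : Matrix (Fin k) (Fin k) ℝ} {c c' : ℝ} {v : Fin k → ℝ}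
    (h : DualBound P c v) (hc : c ≤ c') : DualBound P c' v := fun x =>
  (h x).trans (mul_le_mul_of_nonneg_right hc (wNorm_nonneg _ _))

theorem DualBound.add {k : ℕ} {P : Matrix (Fin k) (Fin k) ℝ} {c c' : ℝ} {v v' : Fin k → ℝ}
    (h : DualBound P c v) (h' : DualBound P c' v') : DualBound P (c + c') (v + v') := fun x => by
  rw [add_dotProduct, add_mul]
  exact (abs_add_le _ _).trans (add_le_add (h x) (h' x))

/-- A contraction between two weights yields, by transposition, a contraction of dual bounds in the
reverse direction. This lets the weight change at each step of a backward recursion without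
inverting it. -/
theorem DualBound.transpose_mulVec {k l : ℕ} {P : Matrix (Fin k) (Fin k) ℝ}
    {Q : Matrix (Fin l) (Fin l) ℝ} {c r : ℝ} {v : Fin k → ℝ} (h : DualBound P c v) (hc : 0 ≤ c)
    {M : Matrix (Fin k) (Fin l) ℝ} (hM : ∀ x, wNorm P (M *ᵥ x) ≤ r * wNorm Q x) :
    DualBound Q (c * r) (Mᵀ *ᵥ v) := fun x => by
  rw [transpose_mulVec_dotProduct, mul_assoc]
  exact (h _).trans (mul_le_mul_of_nonneg_left (hM x) hc)

theorem Matrix.PosSemidef.dualBound {k : ℕ} {P : Matrix (Fin k) (Fin k) ℝ} (hP : P.PosSemidef)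
    (y : Fin k → ℝ) : DualBound P (wNorm P y) (P *ᵥ y) := fun x => by
  rw [dotProduct_comm, mul_comm]
  exact hP.abs_dotProduct_le x y

namespace LQR

variable {n d : ℕ}

/-- `P` is a positive semidefinite fixed point of the Riccati map dominated by `b R_x`. -/
structure IsRiccatiSolution (S : LQR n d) (P : Matrix (Fin n) (Fin n) ℝ) (b : ℝ) : Prop where
  Rx_posDef : S.Rx.PosDef
  Ru_posDef : S.Ru.PosDef
  posSemidef : P.PosSemidef
  ricc_eq : S.ricc P = P
  one_le : 1 ≤ b
  sqNorm_le : ∀ x, sqNorm P x ≤ b * sqNorm S.Rx x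

/-- The contraction rate of the closed loops. -/
noncomputable def rate (b : ℝ) : ℝ := 1 - 1 / (2 * b)

theorem rate_nonneg {b : ℝ} (hb : 1 ≤ b) : 0 ≤ rate b := by
  rw [rate, sub_nonneg, div_le_one (by linarith)]
  linarith

theorem rate_le_one {b : ℝ} (hb : 1 ≤ b) : rate b ≤ 1 := by
  have : 0 ≤ 1 / (2 * b) := by positivity
  rw [rate]
  linarith

theorem mul_rate {b : ℝ} (hb : 1 ≤ b) : 2 * b * rate b = 2 * b - 1 := by
  rw [rate]
  field_simp

namespace IsRiccatiSolution

variable {S : LQR n d} {P Q : Matrix (Fin n) (Fin n) ℝ} {b : ℝ}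

theorem costToGo_posSemidef (H : S.IsRiccatiSolution P b) (k : ℕ) :
    (S.costToGo k).PosSemidef :=
  LQR.costToGo_posSemidef H.Rx_posDef H.Ru_posDef k

theorem hess_posSemidef (H : S.IsRiccatiSolution P b) (hQ : Q.PosSemidef) :
    (S.hess Q).PosSemidef :=
  (hess_posDef H.Ru_posDef hQ).posSemidef

theorem sqNorm_Rx_le (H : S.IsRiccatiSolution P b) (x : Fin n → ℝ) :
    sqNorm S.Rx x ≤ sqNorm P x := by
  have h := sqNorm_Rx_le_ricc (S := S) H.Ru_posDef H.posSemidef x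
  rwa [H.ricc_eq] at h

theorem sqNorm_ricc_le (H : S.IsRiccatiSolution P b) (hQ : Q.PosSemidef)
    (hle : ∀ x, sqNorm Q x ≤ sqNorm P x) (x : Fin n → ℝ) :
    sqNorm (S.ricc Q) x ≤ sqNorm P x := by
  have h := sqNorm_ricc_mono H.Ru_posDef hQ H.posSemidef hle x
  rwa [H.ricc_eq] at h

/-- One step of the optimal loop pays at least `‖x‖²_{R_x}`, which is at least the fraction `1/b` of
`‖x‖²_{ricc Q}` because `ricc Q ≤ P ≤ b R_x`. Hence the factor `1 - 1/b ≤ (1 - 1/(2b))²`. -/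
theorem sqNorm_closed_le (H : S.IsRiccatiSolution P b) (hQ : Q.PosSemidef)
    (hle : ∀ x, sqNorm Q x ≤ sqNorm P x) (x : Fin n → ℝ) :
    sqNorm Q (S.closed Q *ᵥ x) ≤ rate b ^ 2 * sqNorm (S.ricc Q) x := by
  have h1 := cost_add_sqNorm_closed H.Ru_posDef hQ x
  have h2 := H.Ru_posDef.posSemidef.sqNorm_nonneg (S.gain Q *ᵥ x)
  have h3 := (H.sqNorm_ricc_le hQ hle x).trans (H.sqNorm_le x)
  have h4 := H.posSemidef.sqNorm_nonneg x
  have h5 := ricc_posSemidef H.Rx_posDef H.Ru_posDef hQ |>.sqNorm_nonneg x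
  have hb := H.one_le
  have h6 : sqNorm (S.ricc Q) x / b ≤ sqNorm S.Rx x := by
    rw [div_le_iff₀ (by linarith)]
    linarith
  have h7 : rate b ^ 2 * sqNorm (S.ricc Q) x
      = sqNorm (S.ricc Q) x - sqNorm (S.ricc Q) x / b
        + (1 / (2 * b)) ^ 2 * sqNorm (S.ricc Q) x := by
    rw [rate]
    field_simp
    ring
  have h8 : 0 ≤ (1 / (2 * b)) ^ 2 * sqNorm (S.ricc Q) x := by positivity
  linarith

theorem wNorm_closed_le (H : S.IsRiccatiSolution P b) (x : Fin n → ℝ) :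
    wNorm P (S.closed P *ᵥ x) ≤ rate b * wNorm P x := by
  refine wNorm_le_mul (rate_nonneg H.one_le) ?_
  have h := H.sqNorm_closed_le H.posSemidef (fun _ => le_rfl) x
  rwa [H.ricc_eq] at h

/-- Evaluate the completed squares for the terminal costs `P` and `Q` at the same input, the optimal
one for `Q`, and subtract. -/
theorem sqNorm_gain_sub (H : S.IsRiccatiSolution P b) (hQ : Q.PosSemidef) (x : Fin n → ℝ) :
    sqNorm (S.hess P) (S.gain P *ᵥ x - S.gain Q *ᵥ x)
      = sqNorm (P - Q) (S.closed Q *ᵥ x) - sqNorm (P - S.ricc Q) x := by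
  have h1 := cost_add_sqNorm H.Ru_posDef H.posSemidef x (-(S.gain Q *ᵥ x))
  have h2 := cost_add_sqNorm_closed H.Ru_posDef hQ x
  rw [H.ricc_eq, ← closed_mulVec, cost, sqNorm_neg, neg_add_eq_sub] at h1
  rw [sqNorm_matrix_sub, sqNorm_matrix_sub]
  linarith

theorem sqNorm_costToGo_le (H : S.IsRiccatiSolution P b) (k : ℕ) (x : Fin n → ℝ) :
    sqNorm (S.costToGo k) x ≤ sqNorm P x := by
  induction k generalizing x with
  | zero => exact H.sqNorm_Rx_le x
  | succ k ih => exact H.sqNorm_ricc_le (H.costToGo_posSemidef k) ih x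

theorem wNorm_costToGo_le (H : S.IsRiccatiSolution P b) (k : ℕ) (x : Fin n → ℝ) :
    wNorm (S.costToGo k) x ≤ wNorm P x :=
  wNorm_mono (H.sqNorm_costToGo_le k x)

theorem sqNorm_closed_costToGo_le (H : S.IsRiccatiSolution P b) (k : ℕ) (x : Fin n → ℝ) :
    sqNorm (S.costToGo k) (S.closed (S.costToGo k) *ᵥ x)
      ≤ rate b ^ 2 * sqNorm (S.costToGo (k + 1)) x :=
  H.sqNorm_closed_le (H.costToGo_posSemidef k) (H.sqNorm_costToGo_le k) x

theorem wNorm_closed_costToGo_le (H : S.IsRiccatiSolution P b) (k : ℕ) (x : Fin n → ℝ) :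
    wNorm (S.costToGo k) (S.closed (S.costToGo k) *ᵥ x)
      ≤ rate b * wNorm (S.costToGo (k + 1)) x :=
  wNorm_le_mul (rate_nonneg H.one_le) (H.sqNorm_closed_costToGo_le k x)

theorem sub_costToGo_posSemidef (H : S.IsRiccatiSolution P b) (k : ℕ) :
    (P - S.costToGo k).PosSemidef := by
  refine posSemidef_of_sqNorm_nonneg ?_ fun x => ?_
  · rw [Matrix.transpose_sub, H.posSemidef.transpose_eq, (H.costToGo_posSemidef k).transpose_eq]
  · rw [sqNorm_matrix_sub, sub_nonneg]
    exact H.sqNorm_costToGo_le k x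

/-- The Riccati iterates converge to the fixed point at a geometric rate. -/
theorem sqNorm_sub_costToGo_le (H : S.IsRiccatiSolution P b) (k : ℕ) (x : Fin n → ℝ) :
    sqNorm (P - S.costToGo k) x ≤ b * (rate b ^ k) ^ 2 * sqNorm (S.costToGo k) x := by
  have hb := H.one_le
  induction k generalizing x with
  | zero =>
    have h1 := H.sqNorm_le x
    have h2 := H.Rx_posDef.posSemidef.sqNorm_nonneg x
    rw [sqNorm_matrix_sub, costToGo]
    simp only [pow_zero, one_pow, mul_one]
    linarith
  | succ k ih =>
    -- Dropping the nonnegative gain term bounds `P - P_{k+1}` by the pullback of `P - P_k` along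
    -- the closed loop of `P_k`, which contracts.
    have h1 := H.sqNorm_gain_sub (H.costToGo_posSemidef k) x
    have h2 := (H.hess_posSemidef H.posSemidef).sqNorm_nonneg
      (S.gain P *ᵥ x - S.gain (S.costToGo k) *ᵥ x)
    have h3 := ih (S.closed (S.costToGo k) *ᵥ x)
    have h4 := mul_le_mul_of_nonneg_left (H.sqNorm_closed_costToGo_le k x)
      (show 0 ≤ b * (rate b ^ k) ^ 2 by positivity)
    rw [costToGo] at h4 ⊢
    calc _ ≤ _ := by linarith
      _ ≤ _ := h3.trans h4
      _ = _ := by ring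

/-- The gains converge at a geometric rate. -/
theorem wNorm_gain_sub_le (H : S.IsRiccatiSolution P b) (k : ℕ) (x : Fin n → ℝ) :
    wNorm (S.hess P) (S.gain P *ᵥ x - S.gain (S.costToGo k) *ᵥ x)
      ≤ b * rate b ^ k * wNorm (S.costToGo (k + 1)) x := by
  have hb := H.one_le
  have hr := rate_nonneg hb
  refine wNorm_le_mul (by positivity) ?_
  -- The same identity, now dropping the nonnegative form `P - P_{k+1}`.
  have h1 := H.sqNorm_gain_sub (H.costToGo_posSemidef k) x
  have h2 := (H.sub_costToGo_posSemidef (k + 1)).sqNorm_nonneg x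
  have h3 := H.sqNorm_sub_costToGo_le k (S.closed (S.costToGo k) *ᵥ x)
  have h4 := mul_le_mul_of_nonneg_left (H.sqNorm_closed_costToGo_le k x)
      (show 0 ≤ b * (rate b ^ k) ^ 2 by positivity)
  have h5 := (H.costToGo_posSemidef (k + 1)).sqNorm_nonneg x
  have h6 : b * (rate b ^ k) ^ 2 * (rate b ^ 2 * sqNorm (S.costToGo (k + 1)) x)
      ≤ b * (rate b ^ k) ^ 2 * (b * sqNorm (S.costToGo (k + 1)) x) := by
    gcongr
    nlinarith [rate_le_one hb]
  rw [costToGo] at h2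
  calc _ ≤ _ := by linarith
    _ ≤ _ := h3.trans (h4.trans h6)
    _ = _ := by ring

theorem wNorm_hess_le (H : S.IsRiccatiSolution P b) (Q : Matrix (Fin n) (Fin n) ℝ) (u : Fin d → ℝ) :
    wNorm Q (S.B *ᵥ u) ≤ wNorm (S.hess Q) u := by
  refine wNorm_mono ?_
  rw [sqNorm_hess]
  linarith [H.Ru_posDef.posSemidef.sqNorm_nonneg u]

theorem sqNorm_hess_costToGo_le (H : S.IsRiccatiSolution P b) (k : ℕ) (u : Fin d → ℝ) :
    sqNorm (S.hess (S.costToGo k)) u ≤ sqNorm (S.hess P) u := by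
  rw [sqNorm_hess, sqNorm_hess]
  linarith [H.sqNorm_costToGo_le k (S.B *ᵥ u)]

/-- A bounded linear form yields a bounded input. -/
theorem wNorm_inv_le (H : S.IsRiccatiSolution P b) (hQ : Q.PosSemidef) {c : ℝ} (hc : 0 ≤ c)
    {v : Fin n → ℝ} (hv : DualBound Q c v) :
    wNorm (S.hess Q) ((S.hess Q)⁻¹ *ᵥ S.Bᵀ *ᵥ v) ≤ c := by
  refine (H.hess_posSemidef hQ).wNorm_le_of_sqNorm_le hc ?_
  -- For `u` the input in question, `‖u‖²` in the Hessian weight is `⟨v, B u⟩`, and `‖B u‖_Q ≤ ‖u‖`.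
  rw [sqNorm, hess_mulVec_inv H.Ru_posDef hQ, dotProduct_transpose_mulVec, dotProduct_comm]
  exact (le_of_abs_le (hv _)).trans (mul_le_mul_of_nonneg_left (H.wNorm_hess_le Q _) hc)

end IsRiccatiSolution

end LQR

/-! ### The optimal value functions and the advantage -/

namespace LQR

variable {n d : ℕ} (S : LQR n d)

/-- Half of the linear part of the value function with `k` steps to go. -/
noncomputable def linToGo (T : ℕ) (w : ℕ → Fin n → ℝ) : ℕ → Fin n → ℝ
  | 0 => 0
  | k + 1 => (S.closed (S.costToGo k))ᵀ *ᵥ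
      (S.costToGo k *ᵥ w (T - (k + 1)) + linToGo T w k)

/-- Half of the gradient at `A x + B u = 0` of the value function with `k` steps to go. -/
noncomputable def costate (T : ℕ) (w : ℕ → Fin n → ℝ) (k : ℕ) : Fin n → ℝ :=
  S.costToGo k *ᵥ w (T - (k + 1)) + S.linToGo T w k

/-- The offset of the optimal input with `k + 1` steps to go. -/
noncomputable def offset (T : ℕ) (w : ℕ → Fin n → ℝ) (k : ℕ) : Fin d → ℝ :=
  (S.hess (S.costToGo k))⁻¹ *ᵥ S.Bᵀ *ᵥ S.costate T w k

theorem costate_succ (T : ℕ) (w : ℕ → Fin n → ℝ) (k : ℕ) :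
    S.costate T w (k + 1) = S.costToGo (k + 1) *ᵥ w (T - (k + 2))
      + (S.closed (S.costToGo k))ᵀ *ᵥ S.costate T w k := rfl

variable {S}

/-- Completion of the square in the one-step problem with an affine term. -/
theorem exists_cost_add_affine (hRu : S.Ru.PosDef) {P : Matrix (Fin n) (Fin n) ℝ}
    (hP : P.PosSemidef) (w c : Fin n → ℝ) (e : ℝ) : ∃ e', ∀ x u,
    S.cost x u + (sqNorm P (S.A *ᵥ x + S.B *ᵥ u + w) + 2 * (c ⬝ᵥ (S.A *ᵥ x + S.B *ᵥ u + w)) + e)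
      = sqNorm (S.ricc P) x + 2 * (((S.closed P)ᵀ *ᵥ (P *ᵥ w + c)) ⬝ᵥ x) + e'
        + sqNorm (S.hess P)
          (u + (S.gain P *ᵥ x + (S.hess P)⁻¹ *ᵥ S.Bᵀ *ᵥ (P *ᵥ w + c))) := by
  refine ⟨e + sqNorm P w + 2 * (c ⬝ᵥ w)
    - sqNorm (S.hess P) ((S.hess P)⁻¹ *ᵥ S.Bᵀ *ᵥ (P *ᵥ w + c)), fun x u => ?_⟩
  have h1 := cost_add_sqNorm hRu hP x u
  have h2 : (P *ᵥ w + c) ⬝ᵥ (S.A *ᵥ x + S.B *ᵥ u)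
      = (P *ᵥ w + c) ⬝ᵥ (S.closed P *ᵥ x)
        + (u + S.gain P *ᵥ x) ⬝ᵥ S.Bᵀ *ᵥ (P *ᵥ w + c) := by
    rw [dotProduct_transpose_mulVec, dotProduct_comm (S.B *ᵥ _), ← dotProduct_add, closed_mulVec,
      Matrix.mulVec_add, Matrix.mulVec_neg]
    congr 1
    abel
  have h3 : (S.A *ᵥ x + S.B *ᵥ u) ⬝ᵥ P *ᵥ w = (P *ᵥ w) ⬝ᵥ (S.A *ᵥ x + S.B *ᵥ u) :=
    dotProduct_comm _ _
  rw [← add_assoc u, sqNorm_add (hess_posDef hRu hP).posSemidef.transpose_eq,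
    hess_mulVec_inv hRu hP, transpose_mulVec_dotProduct, sqNorm_add hP.transpose_eq _ w, h3,
    dotProduct_add c]
  rw [add_dotProduct] at h2
  linarith

theorem ciInf_add_sqNorm {Q : Matrix (Fin d) (Fin d) ℝ} (hQ : Q.PosSemidef) (a : ℝ)
    (z : Fin d → ℝ) : ⨅ u, (a + sqNorm Q (u + z)) = a := by
  refine le_antisymm ?_ (le_ciInf fun u => le_add_of_nonneg_right (hQ.sqNorm_nonneg _))
  refine (ciInf_le ⟨a, ?_⟩ (-z)).trans (by simp)
  rintro _ ⟨u, rfl⟩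
  exact le_add_of_nonneg_right (hQ.sqNorm_nonneg _)

/-- The constant term stays existential because it cancels in the advantage. -/
theorem exists_valueToGo_eq (hRx : S.Rx.PosDef) (hRu : S.Ru.PosDef) (T : ℕ)
    (w : ℕ → Fin n → ℝ) (k : ℕ) : ∃ e, ∀ x, S.valueToGo T w k x
      = sqNorm (S.costToGo k) x + 2 * (S.linToGo T w k ⬝ᵥ x) + e := by
  induction k with
  | zero => exact ⟨0, fun x => by simp [valueToGo, cost, costToGo, linToGo]⟩
  | succ k ih =>
    obtain ⟨e, he⟩ := ih
    obtain ⟨e', he'⟩ := exists_cost_add_affine hRu (costToGo_posSemidef hRx hRu k)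
      (w (T - (k + 1))) (S.linToGo T w k) e
    refine ⟨e', fun x => ?_⟩
    simp only [valueToGo, he, he']
    exact ciInf_add_sqNorm (hess_posDef hRu (costToGo_posSemidef hRx hRu k)).posSemidef _ _

/-- The square vanishes at `-z`, so minimisers exist and whichever one `pistar` selects has zero
square. -/
theorem advantage_eq_of_Qstar_eq {T t : ℕ} {w : ℕ → Fin n → ℝ} {x : Fin n → ℝ}
    {Q : Matrix (Fin d) (Fin d) ℝ} (hQ : Q.PosSemidef) {a : ℝ} {z : Fin d → ℝ}
    (h : ∀ u, S.Qstar T w t x u = a + sqNorm Q (u + z)) (u : Fin d → ℝ) :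
    S.advantage T w t u x = sqNorm Q (u + z) := by
  have hmin : ∀ v, S.Qstar T w t x (S.pistar T w t x) ≤ S.Qstar T w t x v := by
    refine Classical.epsilon_spec (p := fun u => ∀ v, S.Qstar T w t x u ≤ S.Qstar T w t x v)
      ⟨-z, fun v => ?_⟩
    rw [h, h]
    simpa using hQ.sqNorm_nonneg (v + z)
  have h1 := hmin (-z)
  have h2 := hQ.sqNorm_nonneg (S.pistar T w t x + z)
  rw [h, h, neg_add_cancel, sqNorm_zero] at h1
  rw [advantage, h, h]
  linarith

/-- The advantage before the final time is a quadratic form in the distance to the optimal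
input. -/
theorem advantage_eq (hRx : S.Rx.PosDef) (hRu : S.Ru.PosDef) {T t : ℕ} (ht : t < T)
    (w : ℕ → Fin n → ℝ) (x : Fin n → ℝ) (u : Fin d → ℝ) :
    S.advantage T w t u x = sqNorm (S.hess (S.costToGo (T - (t + 1))))
      (u + (S.gain (S.costToGo (T - (t + 1))) *ᵥ x + S.offset T w (T - (t + 1)))) := by
  have hP := costToGo_posSemidef hRx hRu (T - (t + 1))
  obtain ⟨e, he⟩ := exists_valueToGo_eq hRx hRu T w (T - (t + 1))
  have htw : T - (T - (t + 1) + 1) = t := by omega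
  obtain ⟨e', he'⟩ := exists_cost_add_affine hRu hP (w t) (S.linToGo T w (T - (t + 1))) e
  rw [offset, costate, htw]
  refine advantage_eq_of_Qstar_eq (hess_posDef hRu hP).posSemidef
    (fun v => Eq.trans ?_ (he' x v)) u
  rw [Qstar, if_pos ht, he]

theorem advantage_final (hRu : S.Ru.PosDef) (T : ℕ) (w : ℕ → Fin n → ℝ) (x : Fin n → ℝ)
    (u : Fin d → ℝ) : S.advantage T w T u x = sqNorm S.Ru u := by
  rw [advantage_eq_of_Qstar_eq (a := sqNorm S.Rx x) (z := 0) hRu.posSemidef fun v => ?_, add_zero]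
  simp [Qstar, cost]

/-! ### Comparison of the optimal offsets -/

variable (S) in
/-- The partial sums `∑_{i < N} (Fᵀ)ⁱ P w_{t+i}` for the closed loop `F` of `P`. -/
noncomputable def adjointSum (P : Matrix (Fin n) (Fin n) ℝ) (w : ℕ → Fin n → ℝ) :
    ℕ → ℕ → Fin n → ℝ
  | 0, _ => 0
  | N + 1, t => P *ᵥ w t + (S.closed P)ᵀ *ᵥ adjointSum P w N (t + 1)

theorem adjointSum_eq_sum (P : Matrix (Fin n) (Fin n) ℝ) (w : ℕ → Fin n → ℝ) (N t : ℕ) :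
    S.adjointSum P w N t
      = ∑ i ∈ Finset.range N, ((S.closed P)ᵀ ^ i * P) *ᵥ w (t + i) := by
  induction N generalizing t with
  | zero => simp [adjointSum]
  | succ N ih =>
    rw [adjointSum, ih, Finset.sum_range_succ', add_comm, Matrix.mulVec_sum]
    simp only [Matrix.mulVec_mulVec, pow_succ', Matrix.mul_assoc, pow_zero, one_mul, add_zero]
    congr 1
    exact Finset.sum_congr rfl fun i _ => by rw [add_assoc, add_comm 1 i]

theorem adjointSum_add (P : Matrix (Fin n) (Fin n) ℝ) (w : ℕ → Fin n → ℝ) (N N' t : ℕ) :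
    S.adjointSum P w (N + N') t
      = S.adjointSum P w N t + ((S.closed P)ᵀ ^ N) *ᵥ S.adjointSum P w N' (t + N) := by
  induction N generalizing t with
  | zero => simp [adjointSum]
  | succ N ih =>
    rw [Nat.add_right_comm, adjointSum, adjointSum, ih, Matrix.mulVec_add, pow_succ',
      ← Matrix.mulVec_mulVec, add_assoc t, add_comm 1 N, add_assoc]

theorem qInf_eq (h : ℕ) (w : ℕ → Fin n → ℝ) (t : ℕ) :
    S.qInf h w t = (S.hess S.Pinf)⁻¹ *ᵥ S.Bᵀ *ᵥ S.adjointSum S.Pinf w (h + 1) t := by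
  rw [adjointSum_eq_sum, Matrix.mulVec_sum, Matrix.mulVec_sum, qInf]
  refine Finset.sum_congr rfl fun i _ => ?_
  simp only [Matrix.mulVec_mulVec, ← Matrix.mul_assoc]
  rfl

namespace IsRiccatiSolution

variable {P : Matrix (Fin n) (Fin n) ℝ} {b ω : ℝ} {w : ℕ → Fin n → ℝ}

/-- The constant `2bω` is the fixed point of `c = ω + rate b * c`. -/
theorem dualBound_adjointSum (H : S.IsRiccatiSolution P b) (hω : 0 ≤ ω)
    (hw : ∀ t, wNorm P (w t) ≤ ω) (N t : ℕ) :
    DualBound P (2 * b * ω) (S.adjointSum P w N t) := by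
  have hb := H.one_le
  induction N generalizing t with
  | zero =>
    intro x
    simpa [adjointSum] using mul_nonneg (by positivity) (wNorm_nonneg P x)
  | succ N ih =>
    refine (((H.posSemidef.dualBound (w t)).mono (hw t)).add
      ((ih (t + 1)).transpose_mulVec (by positivity) H.wNorm_closed_le)).mono (le_of_eq ?_)
    linear_combination ω * mul_rate hb

theorem dualBound_costate (H : S.IsRiccatiSolution P b) (hω : 0 ≤ ω)
    (hw : ∀ t, wNorm P (w t) ≤ ω) (T k : ℕ) :
    DualBound (S.costToGo k) (2 * b * ω) (S.costate T w k) := by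
  have hb := H.one_le
  have hwk : ∀ k t, wNorm (S.costToGo k) (w t) ≤ ω := fun k t =>
    (H.wNorm_costToGo_le k _).trans (hw t)
  induction k with
  | zero =>
    rw [costate, linToGo, add_zero]
    exact ((H.costToGo_posSemidef 0).dualBound _).mono ((hwk _ _).trans (by nlinarith))
  | succ k ih =>
    rw [costate_succ]
    refine ((((H.costToGo_posSemidef (k + 1)).dualBound (w _)).mono (hwk _ _)).add
      (ih.transpose_mulVec (by positivity) (H.wNorm_closed_costToGo_le k))).mono (le_of_eq ?_)
    linear_combination ω * mul_rate hb

theorem wNorm_sub_costToGo_le (H : S.IsRiccatiSolution P b) (k : ℕ) (x : Fin n → ℝ) :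
    wNorm (P - S.costToGo k) x ≤ b * rate b ^ k * wNorm (S.costToGo k) x := by
  have hb := H.one_le
  have hr := rate_nonneg hb
  refine wNorm_le_mul (by positivity) ((H.sqNorm_sub_costToGo_le k x).trans ?_)
  have := (H.costToGo_posSemidef k).sqNorm_nonneg x
  rw [mul_pow]
  gcongr
  nlinarith

/-- Cauchy-Schwarz in the form `P - P_k` gains `b * rate b ^ k` from each argument; one of the two
geometric factors is discarded. -/
theorem dualBound_sub_mulVec (H : S.IsRiccatiSolution P b) (k : ℕ) {c : ℝ} (hc : 0 ≤ c)
    {y : Fin n → ℝ} (hy : wNorm (S.costToGo k) y ≤ c) :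
    DualBound (S.costToGo k) (b ^ 2 * rate b ^ k * c) ((P - S.costToGo k) *ᵥ y) := by
  have hb := H.one_le
  have hr := rate_nonneg hb
  have hr1 : rate b ^ k ≤ 1 := pow_le_one₀ hr (rate_le_one hb)
  intro x
  rw [dotProduct_comm]
  have h1 := wNorm_nonneg (S.costToGo k) x
  calc _ ≤ _ := (H.sub_costToGo_posSemidef k).abs_dotProduct_le x y
    _ ≤ (b * rate b ^ k * wNorm (S.costToGo k) x) * (b * rate b ^ k * c) := by
        gcongr
        · exact wNorm_nonneg _ _
        · exact H.wNorm_sub_costToGo_le k x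
        · exact (H.wNorm_sub_costToGo_le k y).trans (by gcongr)
    _ = (b ^ 2 * rate b ^ k * c * wNorm (S.costToGo k) x) * rate b ^ k := by ring
    _ ≤ _ := mul_le_of_le_one_right (by positivity) hr1

theorem rate_two_mul_sub_rate (hb : 1 ≤ b) : rate (2 * b) - rate b = 1 / (4 * b) := by
  rw [rate, rate]
  field_simp
  ring

/-- The difference obeys the costate recursion with a forcing term of order `rate b ^ k`. Iterating
at the same rate would produce a factor `k`; passing to the slower `rate (2 * b)` absorbs it.
Disturbances past the horizon are merely bounded, their effect being damped by the closed loops. -/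
theorem dualBound_adjointSum_sub_costate (H : S.IsRiccatiSolution P b) (hω : 0 ≤ ω)
    (hw : ∀ t, wNorm P (w t) ≤ ω) {T k : ℕ} (hk : k + 1 ≤ T) {N : ℕ} (hN : k ≤ N) :
    DualBound (S.costToGo k) (12 * b ^ 3 * ω * rate (2 * b) ^ k)
      (S.adjointSum P w (N + 1) (T - (k + 1)) - S.costate T w k) := by
  have hb := H.one_le
  have hr := rate_nonneg hb
  have hr1 := rate_le_one hb
  have hr' : 0 ≤ rate (2 * b) := rate_nonneg (by linarith)
  have hgap := rate_two_mul_sub_rate hb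
  have hrr : rate b ≤ rate (2 * b) := by
    have : 0 ≤ 1 / (4 * b) := by positivity
    linarith
  have hwk : ∀ k t, wNorm (S.costToGo k) (w t) ≤ ω := fun k t =>
    (H.wNorm_costToGo_le k _).trans (hw t)
  induction k generalizing N with
  | zero =>
    have h0 : ∀ x, wNorm P (S.closed P *ᵥ x) ≤ b * wNorm (S.costToGo 0) x := fun x => by
      have h1 : wNorm P x ≤ b * wNorm (S.costToGo 0) x := by
        refine wNorm_le_mul (by linarith) ((H.sqNorm_le x).trans ?_)
        have := H.Rx_posDef.posSemidef.sqNorm_nonneg x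
        rw [costToGo]
        gcongr
        nlinarith
      refine (H.wNorm_closed_le x).trans (le_trans ?_ h1)
      exact mul_le_of_le_one_left (wNorm_nonneg _ _) hr1
    have e : S.adjointSum P w (N + 1) (T - (0 + 1)) - S.costate T w 0
        = (P - S.costToGo 0) *ᵥ w (T - (0 + 1))
          + (S.closed P)ᵀ *ᵥ S.adjointSum P w N (T - (0 + 1) + 1) := by
      rw [adjointSum, costate, linToGo, Matrix.sub_mulVec]
      abel
    rw [e]
    refine ((H.dualBound_sub_mulVec 0 hω (hwk 0 _)).add
      ((H.dualBound_adjointSum hω hw N _).transpose_mulVec (by positivity) h0)).mono ?_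
    have : b ^ 2 * ω ≤ b ^ 3 * ω := by gcongr; linarith
    simp only [pow_zero, mul_one]
    nlinarith
  | succ k ih =>
    obtain ⟨N, rfl⟩ : ∃ N', N = N' + 1 := ⟨N - 1, by omega⟩
    have ht : T - (k + 1 + 1) + 1 = T - (k + 1) := by omega
    set G := S.adjointSum P w (N + 1) (T - (k + 1)) with hG
    have hGb : DualBound P (2 * b * ω) G := H.dualBound_adjointSum hω hw _ _
    -- The three terms come from the mismatch of the weights, the propagated error, and the mismatch
    -- of the gains.
    have e : S.adjointSum P w (N + 1 + 1) (T - (k + 1 + 1)) - S.costate T w (k + 1)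
        = (P - S.costToGo (k + 1)) *ᵥ w (T - (k + 2))
          + (S.closed (S.costToGo k))ᵀ *ᵥ (G - S.costate T w k)
          + (S.B * (S.gain (S.costToGo k) - S.gain P))ᵀ *ᵥ G := by
      have hF : (S.closed P)ᵀ = (S.closed (S.costToGo k))ᵀ
          + (S.B * (S.gain (S.costToGo k) - S.gain P))ᵀ := by
        rw [← Matrix.transpose_add, closed, closed, Matrix.mul_sub]
        congr 1
        abel
      rw [adjointSum, costate_succ, ht, ← hG, hF, Matrix.sub_mulVec, Matrix.mulVec_sub,
        Matrix.add_mulVec]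
      abel
    have hgain : ∀ x, wNorm P ((S.B * (S.gain (S.costToGo k) - S.gain P)) *ᵥ x)
        ≤ b * rate b ^ k * wNorm (S.costToGo (k + 1)) x := fun x => by
      rw [← Matrix.mulVec_mulVec, Matrix.sub_mulVec, ← wNorm_neg, ← Matrix.mulVec_neg, neg_sub]
      exact (H.wNorm_hess_le P _).trans (H.wNorm_gain_sub_le k x)
    rw [e]
    refine (((H.dualBound_sub_mulVec (k + 1) hω (hwk _ _)).add
      ((ih (by omega) (by omega)).transpose_mulVec (by positivity)
        (H.wNorm_closed_costToGo_le k))).add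
      (hGb.transpose_mulVec (by positivity) hgain)).mono ?_
    have h1 : rate b ^ k ≤ rate (2 * b) ^ k := pow_le_pow_left₀ hr hrr k
    have h2 : rate b ^ (k + 1) ≤ rate (2 * b) ^ k := by
      rw [pow_succ]
      exact (mul_le_of_le_one_right (by positivity) hr1).trans h1
    -- The rate gap `1/(4b)` leaves room `12b³/(4b) = 3b²`, enough for the forcing terms `b²` and
    -- `2b²`.
    have h3 : 12 * b ^ 3 * ω * rate (2 * b) ^ (k + 1)
        = 12 * b ^ 3 * ω * rate (2 * b) ^ k * rate b + 3 * b ^ 2 * ω * rate (2 * b) ^ k := by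
      have h : 12 * b ^ 3 * (rate (2 * b) - rate b) = 3 * b ^ 2 := by
        rw [hgap]
        field_simp
        norm_num
      linear_combination ω * rate (2 * b) ^ k * h
    rw [h3]
    have h4 : b ^ 2 * rate b ^ (k + 1) * ω ≤ b ^ 2 * rate (2 * b) ^ k * ω := by gcongr
    have h5 : 2 * b * ω * (b * rate b ^ k) ≤ 2 * b * ω * (b * rate (2 * b) ^ k) := by gcongr
    linarith

/-- The finite-horizon offsets converge to the infinite-horizon ones at a geometric rate. -/
theorem wNorm_offset_sub_le (H : S.IsRiccatiSolution P b) (hω : 0 ≤ ω)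
    (hw : ∀ t, wNorm P (w t) ≤ ω) {T k : ℕ} (hk : k + 1 ≤ T) {N : ℕ} (hN : k ≤ N) :
    wNorm (S.hess P) ((S.hess P)⁻¹ *ᵥ S.Bᵀ *ᵥ S.adjointSum P w (N + 1) (T - (k + 1))
      - S.offset T w k) ≤ 14 * b ^ 3 * ω * rate (2 * b) ^ k := by
  have hb := H.one_le
  have hr := rate_nonneg hb
  have hr' : 0 ≤ rate (2 * b) := rate_nonneg (by linarith)
  have hrr : rate b ≤ rate (2 * b) := by
    have : 0 ≤ 1 / (4 * b) := by positivity
    linarith [rate_two_mul_sub_rate hb]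
  set G := S.adjointSum P w (N + 1) (T - (k + 1))
  set p := (S.hess P)⁻¹ *ᵥ S.Bᵀ *ᵥ G with hp
  set p' := S.offset T w k with hp'
  have hPk := H.costToGo_posSemidef k
  have hp'b : wNorm (S.costToGo k) (S.B *ᵥ p') ≤ 2 * b * ω :=
    (H.wNorm_hess_le _ _).trans
      (H.wNorm_inv_le hPk (by positivity) (H.dualBound_costate hω hw T k))
  refine (H.hess_posSemidef H.posSemidef).wNorm_le_of_sqNorm_le (by positivity) ?_
  -- Subtract the two normal equations; replacing `hess P_k` by `hess P` costs `Bᵀ (P - P_k) B p'`.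
  have hsplit : S.hess P *ᵥ (p - p')
      = S.Bᵀ *ᵥ ((G - S.costate T w k) - (P - S.costToGo k) *ᵥ S.B *ᵥ p') := by
    have h1 : S.hess P *ᵥ p = S.Bᵀ *ᵥ G := hess_mulVec_inv H.Ru_posDef H.posSemidef _
    have h2 : S.hess (S.costToGo k) *ᵥ p' = S.Bᵀ *ᵥ S.costate T w k :=
      hess_mulVec_inv H.Ru_posDef hPk _
    have h3 : S.hess P *ᵥ p'
        = S.hess (S.costToGo k) *ᵥ p' + S.Bᵀ *ᵥ (P - S.costToGo k) *ᵥ S.B *ᵥ p' := by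
      simp only [hess, Matrix.add_mulVec, Matrix.sub_mulVec, ← Matrix.mulVec_mulVec,
        Matrix.mulVec_sub]
      abel
    rw [Matrix.mulVec_sub, h1, h3, h2, Matrix.mulVec_sub, Matrix.mulVec_sub]
    abel
  have hdual : DualBound (S.costToGo k) (14 * b ^ 3 * ω * rate (2 * b) ^ k)
      ((G - S.costate T w k) + (P - S.costToGo k) *ᵥ (-(S.B *ᵥ p'))) := by
    refine ((H.dualBound_adjointSum_sub_costate hω hw hk hN).add
      (H.dualBound_sub_mulVec k (c := 2 * b * ω) (by positivity) (by rwa [wNorm_neg]))).mono ?_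
    have : rate b ^ k ≤ rate (2 * b) ^ k := pow_le_pow_left₀ hr hrr k
    have : b ^ 2 * rate b ^ k * (2 * b * ω) ≤ b ^ 2 * rate (2 * b) ^ k * (2 * b * ω) := by gcongr
    linarith
  rw [Matrix.mulVec_neg, ← sub_eq_add_neg] at hdual
  rw [sqNorm, hsplit, dotProduct_transpose_mulVec, dotProduct_comm]
  refine (le_of_abs_le (hdual _)).trans ?_
  gcongr
  exact (H.wNorm_costToGo_le k _).trans (H.wNorm_hess_le _ _)

end IsRiccatiSolution

end LQR

/-! ### The approximation error of the advantage -/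

namespace LQR

variable {n d : ℕ} {S : LQR n d}

/-- Changing the weight at `x` costs the `ρ` term; changing the argument costs a difference of
squares, factored by the triangle inequality. -/
theorem abs_sqNorm_sub_sqNorm_le {k : ℕ} {Q Q' : Matrix (Fin k) (Fin k) ℝ} (hQ : Q.PosSemidef)
    {ρ : ℝ} {x : Fin k → ℝ} (hle : sqNorm Q' x ≤ sqNorm Q x)
    (hge : sqNorm Q x - sqNorm Q' x ≤ ρ * sqNorm Q x) (y : Fin k → ℝ) :
    |sqNorm Q' x - sqNorm Q y|
      ≤ ρ * wNorm Q x ^ 2 + wNorm Q (x - y) * (wNorm Q x + wNorm Q y) := by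
  have h1 := hQ.wNorm_add_le (x - y) y
  have h2 := hQ.wNorm_sub_le x (x - y)
  rw [sub_add_cancel] at h1
  rw [sub_sub_cancel] at h2
  rw [← hQ.wNorm_sq] at hle hge
  rw [← hQ.wNorm_sq]
  have h3 := wNorm_nonneg Q x
  have h4 := wNorm_nonneg Q y
  rw [abs_le]
  constructor <;> nlinarith

namespace IsRiccatiSolution

variable {P : Matrix (Fin n) (Fin n) ℝ} {b ω : ℝ} {w : ℕ → Fin n → ℝ}

theorem wNorm_adjointSum_tail_le (H : S.IsRiccatiSolution P b) (hω : 0 ≤ ω)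
    (hw : ∀ t, wNorm P (w t) ≤ ω) {γ : ℝ} (hγ : 0 ≤ γ)
    (hclosed : ∀ x, wNorm P (S.closed P *ᵥ x) ≤ γ * wNorm P x) (N N' t : ℕ) :
    wNorm (S.hess P) ((S.hess P)⁻¹ *ᵥ S.Bᵀ *ᵥ S.adjointSum P w (N + N') t
      - (S.hess P)⁻¹ *ᵥ S.Bᵀ *ᵥ S.adjointSum P w N t) ≤ 2 * b * ω * γ ^ N := by
  have hb := H.one_le
  have hpow : ∀ x, wNorm P (S.closed P ^ N *ᵥ x) ≤ γ ^ N * wNorm P x := by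
    induction N with
    | zero => simp
    | succ N ih =>
      intro x
      rw [pow_succ', ← Matrix.mulVec_mulVec, pow_succ', mul_assoc]
      exact (hclosed _).trans (mul_le_mul_of_nonneg_left (ih x) hγ)
  rw [← Matrix.mulVec_sub, ← Matrix.mulVec_sub, adjointSum_add, add_sub_cancel_left,
    ← Matrix.transpose_pow]
  exact H.wNorm_inv_le H.posSemidef (by positivity)
    ((H.dualBound_adjointSum hω hw N' _).transpose_mulVec (by positivity) hpow)

/-- The error of the approximate advantage at one step before the final time. -/
theorem abs_step_sub_le (H : S.IsRiccatiSolution P b) (hω : 0 ≤ ω)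
    (hw : ∀ t, wNorm P (w t) ≤ ω) {γ τ : ℝ} (hγ : 0 ≤ γ)
    (hclosed : ∀ x, wNorm P (S.closed P *ᵥ x) ≤ γ * wNorm P x) {h : ℕ} (hτ : γ ^ (h + 1) ≤ τ)
    (hτ1 : τ ≤ 1) {c : ℝ} (hωc : ω ≤ c) {x : Fin n → ℝ} (hx : wNorm P x ≤ 4 * b * c)
    {q : Fin d → ℝ} (hq : wNorm (S.hess P) q ≤ c) {T t : ℕ} (ht : t < T) :
    |sqNorm (S.hess (S.costToGo (T - (t + 1)))) (-(S.gain P *ᵥ x) - q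
        + (S.gain (S.costToGo (T - (t + 1))) *ᵥ x + S.offset T w (T - (t + 1))))
      - sqNorm (S.hess P) (q - (S.hess P)⁻¹ *ᵥ S.Bᵀ *ᵥ S.adjointSum P w (h + 1) t)|
      ≤ 1000 * b ^ 7 * c ^ 2 * rate (2 * b) ^ (T - (t + 1)) + 52 * b ^ 7 * c ^ 2 * τ := by
  have hb := H.one_le
  have hr := rate_nonneg hb
  have hr' : 0 ≤ rate (2 * b) := rate_nonneg (by linarith)
  have hrr : rate b ≤ rate (2 * b) := by
    have : 0 ≤ 1 / (4 * b) := by positivity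
    linarith [rate_two_mul_sub_rate hb]
  have hc : 0 ≤ c := hω.trans hωc
  have hτ0 : 0 ≤ τ := (pow_nonneg hγ _).trans hτ
  have hH := H.hess_posSemidef H.posSemidef
  set k := T - (t + 1) with hk
  have htk : T - (k + 1) = t := by omega
  -- The choice `N = h + T` makes the adjoint sum long enough for the offset comparison and splits
  -- it into the `h + 1` retained terms and a tail of length `T`.
  have hoff := H.wNorm_offset_sub_le hω hw (T := T) (k := k) (by omega) (N := h + T) (by omega)
  rw [htk, Nat.add_right_comm] at hoff
  have htail := H.wNorm_adjointSum_tail_le hω hw hγ hclosed (h + 1) T t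
  set p := (S.hess P)⁻¹ *ᵥ S.Bᵀ *ᵥ S.adjointSum P w (h + 1 + T) t
  have hph := H.wNorm_inv_le H.posSemidef (by positivity) (H.dualBound_adjointSum hω hw (h + 1) t)
  set ph := (S.hess P)⁻¹ *ᵥ S.Bᵀ *ᵥ S.adjointSum P w (h + 1) t
  set a := -(S.gain P *ᵥ x) - q + (S.gain (S.costToGo k) *ᵥ x + S.offset T w k) with ha
  set s := rate (2 * b) ^ k with hs
  have hs0 : 0 ≤ s := pow_nonneg hr' k
  have hs1 : s ≤ 1 := pow_le_one₀ hr' (rate_le_one (by linarith))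
  have hrs : rate b ^ k ≤ s := pow_le_pow_left₀ hr hrr k
  have hgain := H.wNorm_gain_sub_le k x
  have hdiff : wNorm (S.hess P) (a - (ph - q)) ≤ 18 * b ^ 3 * c * s + 2 * b * c * τ := by
    -- Truncation error, gain error and offset error, contributing `2bcτ`, `4b²cs` and `14b³cs`.
    have e : a - (ph - q) = (p - ph) - ((S.gain P *ᵥ x - S.gain (S.costToGo k) *ᵥ x)
        + (p - S.offset T w k)) := by
      rw [ha]
      abel
    rw [e]
    have h1 : b * rate b ^ k * wNorm (S.costToGo (k + 1)) x ≤ b * s * (4 * b * c) := by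
      gcongr
      · exact wNorm_nonneg _ _
      · exact (H.wNorm_costToGo_le _ _).trans hx
    have h2 : 14 * b ^ 3 * ω * s ≤ 14 * b ^ 3 * c * s := by gcongr
    have h3 : 2 * b * ω * γ ^ (h + 1) ≤ 2 * b * c * τ := by gcongr
    have h4 : b ^ 2 * (c * s) ≤ b ^ 3 * (c * s) := by gcongr; norm_num
    have h5 := hH.wNorm_sub_le (p - ph) ((S.gain P *ᵥ x - S.gain (S.costToGo k) *ᵥ x)
        + (p - S.offset T w k))
    have h6 := hH.wNorm_add_le (S.gain P *ᵥ x - S.gain (S.costToGo k) *ᵥ x)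
      (p - S.offset T w k)
    linarith
  have hpq : wNorm (S.hess P) (ph - q) ≤ 3 * b ^ 3 * c := by
    have h1 := hH.wNorm_sub_le ph q
    have h2 : 2 * b * ω ≤ 2 * b ^ 3 * c := by
      gcongr
      exact le_self_pow₀ hb (by norm_num)
    have h3 : 1 * c ≤ b ^ 3 * c := by
      gcongr
      exact one_le_pow₀ hb
    linarith
  have hb3 : b ≤ b ^ 3 := le_self_pow₀ hb (by norm_num)
  have ha' : wNorm (S.hess P) a ≤ 23 * b ^ 3 * c := by
    have h1 := hH.wNorm_add_le (a - (ph - q)) (ph - q)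
    rw [sub_add_cancel] at h1
    have h2 : 18 * b ^ 3 * c * s ≤ 18 * b ^ 3 * c := mul_le_of_le_one_right (by positivity) hs1
    have h3 : 2 * b * c * τ ≤ 2 * b ^ 3 * c * 1 := by gcongr
    linarith
  have hlast : sqNorm (S.hess P) (q - ph) = sqNorm (S.hess P) (ph - q) := by
    rw [← sqNorm_neg, neg_sub]
  rw [hlast]
  have hρ : sqNorm (S.hess P) a - sqNorm (S.hess (S.costToGo k)) a
      ≤ b * s * sqNorm (S.hess P) a := by
    have h1 := H.sqNorm_sub_costToGo_le k (S.B *ᵥ a)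
    have h2 : sqNorm (S.costToGo k) (S.B *ᵥ a) ≤ sqNorm (S.hess P) a := by
      rw [sqNorm_hess]
      linarith [H.sqNorm_costToGo_le k (S.B *ᵥ a), H.Ru_posDef.posSemidef.sqNorm_nonneg a]
    have h3 := (H.costToGo_posSemidef k).sqNorm_nonneg (S.B *ᵥ a)
    have h4 : (rate b ^ k) ^ 2 ≤ s := by
      have : rate b ^ k ≤ 1 := pow_le_one₀ hr (rate_le_one hb)
      nlinarith [pow_nonneg hr k]
    calc sqNorm (S.hess P) a - sqNorm (S.hess (S.costToGo k)) a
        = sqNorm (P - S.costToGo k) (S.B *ᵥ a) := by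
          rw [sqNorm_hess, sqNorm_hess, sqNorm_matrix_sub]
          ring
      _ ≤ _ := h1
      _ ≤ _ := by gcongr
  -- The constants are `23² + 18·26 = 997 ≤ 1000` for `s` and `2·26 = 52` for `τ`.
  refine (abs_sqNorm_sub_sqNorm_le hH (H.sqNorm_hess_costToGo_le k a) hρ (ph - q)).trans ?_
  have h1 : b * s * wNorm (S.hess P) a ^ 2 ≤ b * s * (23 * b ^ 3 * c) ^ 2 := by
    gcongr
    exact wNorm_nonneg _ _
  have h2 : wNorm (S.hess P) (a - (ph - q)) * (wNorm (S.hess P) a + wNorm (S.hess P) (ph - q))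
      ≤ (18 * b ^ 3 * c * s + 2 * b * c * τ) * (23 * b ^ 3 * c + 3 * b ^ 3 * c) := by
    gcongr
    exact add_nonneg (wNorm_nonneg _ _) (wNorm_nonneg _ _)
  have h3 : b ^ 6 * (c ^ 2 * s) ≤ b ^ 7 * (c ^ 2 * s) := by gcongr; norm_num
  have h4 : b ^ 4 * (c ^ 2 * τ) ≤ b ^ 7 * (c ^ 2 * τ) := by gcongr; norm_num
  have h5 : 0 ≤ b ^ 7 * (c ^ 2 * s) := by positivity
  nlinarith

/-- The error of the approximate advantage at the final time. -/
theorem abs_final_sub_le (H : S.IsRiccatiSolution P b) (hω : 0 ≤ ω)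
    (hw : ∀ t, wNorm P (w t) ≤ ω) {c : ℝ} (hωc : ω ≤ c) {x : Fin n → ℝ}
    (hx : wNorm P x ≤ 4 * b * c) {q : Fin d → ℝ} (hq : wNorm (S.hess P) q ≤ c) (N t : ℕ) :
    |sqNorm S.Ru (-(S.gain P *ᵥ x) - q)
      - sqNorm (S.hess P) (q - (S.hess P)⁻¹ *ᵥ S.Bᵀ *ᵥ S.adjointSum P w N t)|
      ≤ 34 * b ^ 2 * c ^ 2 := by
  have hb := H.one_le
  have hc : 0 ≤ c := hω.trans hωc
  have hbc : c ≤ b * c := le_mul_of_one_le_left hc hb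
  have hH := H.hess_posSemidef H.posSemidef
  have hRu := H.Ru_posDef.posSemidef
  have hgain : wNorm S.Ru (-(S.gain P *ᵥ x)) ≤ wNorm P x := by
    rw [wNorm_neg]
    refine wNorm_mono ?_
    have h := cost_add_sqNorm_closed H.Ru_posDef H.posSemidef x
    rw [H.ricc_eq] at h
    linarith [H.Rx_posDef.posSemidef.sqNorm_nonneg x, H.posSemidef.sqNorm_nonneg (S.closed P *ᵥ x)]
  have hRuq : wNorm S.Ru q ≤ wNorm (S.hess P) q := by
    refine wNorm_mono ?_
    rw [sqNorm_hess]
    linarith [H.posSemidef.sqNorm_nonneg (S.B *ᵥ q)]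
  have hu : wNorm S.Ru (-(S.gain P *ᵥ x) - q) ≤ 5 * b * c := by
    linarith [hRu.wNorm_sub_le (-(S.gain P *ᵥ x)) q]
  have hp := H.wNorm_inv_le H.posSemidef (by positivity) (H.dualBound_adjointSum hω hw N t)
  have hqp := hH.wNorm_sub_le q ((S.hess P)⁻¹ *ᵥ S.Bᵀ *ᵥ S.adjointSum P w N t)
  have hqp' : wNorm (S.hess P) (q - (S.hess P)⁻¹ *ᵥ S.Bᵀ *ᵥ S.adjointSum P w N t)
      ≤ 3 * b * c := by
    have : 2 * b * ω ≤ 2 * b * c := by gcongr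
    linarith
  rw [← hRu.wNorm_sq, ← hH.wNorm_sq]
  have h1 := pow_le_pow_left₀ (wNorm_nonneg _ _) hu 2
  have h2 := pow_le_pow_left₀ (wNorm_nonneg _ _) hqp' 2
  rw [abs_le]
  constructor <;> nlinarith [sq_nonneg (wNorm S.Ru (-(S.gain P *ᵥ x) - q)),
    sq_nonneg (wNorm (S.hess P) (q - (S.hess P)⁻¹ *ᵥ S.Bᵀ *ᵥ S.adjointSum P w N t)),
    sq_nonneg (b * c)]

/-- The states of a disturbance-action policy are bounded. -/
theorem wNorm_state_le (H : S.IsRiccatiSolution S.Pinf b) (hω : 0 ≤ ω)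
    (hw : ∀ t, wNorm S.Pinf (w t) ≤ ω) {c : ℝ} (hωc : ω ≤ c) {T m : ℕ}
    {M : ℕ → (ℕ → Fin n → ℝ) → Fin m → Matrix (Fin d) (Fin n) ℝ}
    (hM : ∀ t ∈ Finset.Icc 1 T, wNorm (S.hess S.Pinf) (dapBias (M t w) w t) ≤ c) {t : ℕ}
    (ht : t ≤ T) : wNorm S.Pinf (S.state (S.dapPolicy M) w t) ≤ 4 * b * c := by
  have hb := H.one_le
  have hc : 0 ≤ c := hω.trans hωc
  have h0 : wNorm S.Pinf 0 ≤ 4 * b * c := by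
    rw [wNorm, sqNorm_zero, Real.sqrt_zero]
    positivity
  induction t with
  | zero => exact h0
  | succ t ih =>
    rcases t with _ | t
    · exact h0
    · have hq := hM (t + 1) (Finset.mem_Icc.2 ⟨by omega, by omega⟩)
      have hx := ih (by omega)
      rw [state]
      set x := S.state (S.dapPolicy M) w (t + 1)
      have e : S.A *ᵥ x + S.B *ᵥ S.dapPolicy M (t + 1) x w + w (t + 1)
          = (S.closed S.Pinf *ᵥ x - S.B *ᵥ dapBias (M (t + 1) w) w (t + 1)) + w (t + 1) := by
        rw [closed_mulVec, dapPolicy, Matrix.mulVec_sub, ← add_sub_assoc]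
        rfl
      rw [e]
      have h1 := H.posSemidef.wNorm_add_le
        (S.closed S.Pinf *ᵥ x - S.B *ᵥ dapBias (M (t + 1) w) w (t + 1)) (w (t + 1))
      have h2 := H.posSemidef.wNorm_sub_le (S.closed S.Pinf *ᵥ x)
        (S.B *ᵥ dapBias (M (t + 1) w) w (t + 1))
      have h3 := (H.wNorm_closed_le x).trans
        (mul_le_mul_of_nonneg_left hx (rate_nonneg hb))
      have h4 := H.wNorm_hess_le S.Pinf (dapBias (M (t + 1) w) w (t + 1))
      have h5 := hw (t + 1)
      -- The radius `4bc` is the fixed point of `y = rate b * y + 2c`, where `2c` covers the bias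
      -- and the disturbance.
      have h6 : rate b * (4 * b * c) = 4 * b * c - 2 * c := by
        linear_combination 2 * c * mul_rate hb
      linarith

theorem sum_rate_pow_le (hb : 1 ≤ b) (T : ℕ) :
    ∑ t ∈ Finset.Ico 1 T, rate (2 * b) ^ (T - (t + 1)) ≤ 4 * b := by
  have hr : 0 ≤ rate (2 * b) := rate_nonneg (by linarith)
  have hr1 : 1 - rate (2 * b) = 1 / (4 * b) := by
    rw [rate]
    ring
  calc ∑ t ∈ Finset.Ico 1 T, rate (2 * b) ^ (T - (t + 1))
      ≤ ∑ t ∈ Finset.range T, rate (2 * b) ^ (T - 1 - t) := by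
        rw [Finset.sum_congr rfl fun t _ => by rw [show T - (t + 1) = T - 1 - t by omega]]
        refine Finset.sum_le_sum_of_subset_of_nonneg (fun t ht => ?_)
          fun t _ _ => pow_nonneg hr _
        simp only [Finset.mem_Ico, Finset.mem_range] at ht ⊢
        omega
    _ = ∑ j ∈ Finset.range T, rate (2 * b) ^ j :=
        Finset.sum_range_reflect (fun j => rate (2 * b) ^ j) T
    _ ≤ 4 * b := by
        have h1 := mul_neg_geom_sum (rate (2 * b)) T
        have h2 := pow_nonneg hr T
        rw [hr1] at h1
        have h3 : 1 / (4 * b) * ∑ j ∈ Finset.range T, rate (2 * b) ^ j ≤ 1 := by linarith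
        rwa [one_div_mul_eq_div, div_le_one (by linarith)] at h3

/-- The total approximation error of the advantage along a disturbance-action policy. -/
theorem sum_abs_advantage_sub_le (H : S.IsRiccatiSolution S.Pinf b) (hω : 0 ≤ ω)
    (hw : ∀ t, wNorm S.Pinf (w t) ≤ ω) {γ : ℝ} (hγ : 0 ≤ γ)
    (hclosed : ∀ x, wNorm S.Pinf (S.closed S.Pinf *ᵥ x) ≤ γ * wNorm S.Pinf x) {T h m : ℕ}
    (hT : 1 ≤ T) (hτ : γ ^ (h + 1) ≤ (T : ℝ)⁻¹) {c : ℝ} (hωc : ω ≤ c)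
    {M : ℕ → (ℕ → Fin n → ℝ) → Fin m → Matrix (Fin d) (Fin n) ℝ}
    (hM : ∀ t ∈ Finset.Icc 1 T, wNorm (S.hess S.Pinf) (dapBias (M t w) w t) ≤ c) :
    ∑ t ∈ Finset.Icc 1 T,
        |S.advantage T w t (S.input (S.dapPolicy M) w t) (S.state (S.dapPolicy M) w t)
          - S.approxAdvantage h (M t w) w t| ≤ 4086 * b ^ 8 * c ^ 2 := by
  have hb := H.one_le
  have hT' : (1 : ℝ) ≤ T := by exact_mod_cast hT
  have hstep : ∀ t ∈ Finset.Ico 1 T,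
      |S.advantage T w t (S.input (S.dapPolicy M) w t) (S.state (S.dapPolicy M) w t)
          - S.approxAdvantage h (M t w) w t|
        ≤ 1000 * b ^ 7 * c ^ 2 * rate (2 * b) ^ (T - (t + 1))
          + 52 * b ^ 7 * c ^ 2 * (T : ℝ)⁻¹ := by
    intro t ht
    rw [Finset.mem_Ico] at ht
    rw [advantage_eq H.Rx_posDef H.Ru_posDef ht.2, approxAdvantage, qInf_eq]
    exact H.abs_step_sub_le hω hw hγ hclosed hτ (inv_le_one_of_one_le₀ hT') hωc
      (H.wNorm_state_le hω hw hωc hM ht.2.le) (hM t (Finset.mem_Icc.2 ⟨ht.1, ht.2.le⟩)) ht.2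
  have hfinal : |S.advantage T w T (S.input (S.dapPolicy M) w T) (S.state (S.dapPolicy M) w T)
          - S.approxAdvantage h (M T w) w T| ≤ 34 * b ^ 2 * c ^ 2 := by
    rw [advantage_final H.Ru_posDef, approxAdvantage, qInf_eq]
    exact H.abs_final_sub_le hω hw hωc (H.wNorm_state_le hω hw hωc hM le_rfl)
      (hM T (Finset.mem_Icc.2 ⟨hT, le_rfl⟩)) _ _
  rw [← Finset.Ico_insert_right hT, Finset.sum_insert Finset.right_notMem_Ico]
  have hsum := Finset.sum_le_sum hstep
  rw [Finset.sum_add_distrib, ← Finset.mul_sum, Finset.sum_const, Nat.card_Ico, nsmul_eq_mul] at hsum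
  -- The total is `1000·4 + 52 + 34 = 4086`.
  have h1 := mul_le_mul_of_nonneg_left (sum_rate_pow_le hb T)
    (show 0 ≤ 1000 * b ^ 7 * c ^ 2 by positivity)
  have h2 : ((T - 1 : ℕ) : ℝ) * (52 * b ^ 7 * c ^ 2 * (T : ℝ)⁻¹) ≤ 52 * b ^ 7 * c ^ 2 := by
    calc ((T - 1 : ℕ) : ℝ) * (52 * b ^ 7 * c ^ 2 * (T : ℝ)⁻¹)
        ≤ (T : ℝ) * (52 * b ^ 7 * c ^ 2 * (T : ℝ)⁻¹) := by
          gcongr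
          omega
      _ = _ := by field_simp
  have h3 : b ^ 7 * c ^ 2 ≤ b ^ 8 * c ^ 2 := by gcongr; norm_num
  have h4 : b ^ 2 * c ^ 2 ≤ b ^ 8 * c ^ 2 := by gcongr; norm_num
  linarith

end IsRiccatiSolution

end LQR

/-! ### Bounds in terms of the problem parameters -/

theorem lambdaMin_mul_dotProduct_le {k : ℕ} {R : Matrix (Fin k) (Fin k) ℝ} (hR : R.PosDef)
    (x : Fin k → ℝ) : lambdaMin R * (x ⬝ᵥ x) ≤ sqNorm R x := by
  have hbdd : BddBelow (spectrum ℝ R) := by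
    rw [hR.isHermitian.spectrum_real_eq_range_eigenvalues]
    exact (Set.finite_range _).bddBelow
  have hle : algebraMap ℝ (Matrix (Fin k) (Fin k) ℝ) (lambdaMin R) ≤ R :=
    (algebraMap_le_iff_le_spectrum (ha := hR.isHermitian)).2 fun y hy => csInf_le hbdd hy
  have h := (Matrix.le_iff.1 hle).sqNorm_nonneg x
  rw [sqNorm_matrix_sub, Algebra.algebraMap_eq_smul_one] at h
  simpa [sqNorm, Matrix.smul_mulVec] using h

/-- In dimension zero the spectrum is empty and `sInf` returns `0`, hence the condition on `k`. -/
theorem lambdaMin_pos {k : ℕ} (hk : 0 < k) {R : Matrix (Fin k) (Fin k) ℝ} (hR : R.PosDef) :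
    0 < lambdaMin R := by
  have : Nonempty (Fin k) := ⟨⟨0, hk⟩⟩
  have hmem : lambdaMin R ∈ Set.range hR.isHermitian.eigenvalues := by
    rw [lambdaMin, hR.isHermitian.spectrum_real_eq_range_eigenvalues]
    exact (Set.range_nonempty _).csInf_mem (Set.finite_range _)
  obtain ⟨i, hi⟩ := hmem
  rw [← hi]
  exact hR.eigenvalues_pos i

namespace LQR

variable {n d : ℕ} {S : LQR n d}

theorem one_le_beta (S : LQR n d) : 1 ≤ S.beta := le_max_left _ _

theorem one_le_Gam (S : LQR n d) : 1 ≤ S.Gam := le_max_left _ _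

theorem one_le_Psi (S : LQR n d) : 1 ≤ S.Psi := le_max_left _ _

theorem norm_B_le_Psi (S : LQR n d) : ‖S.B‖ ≤ S.Psi := by simp [Psi]

theorem norm_Ru_le_Psi (S : LQR n d) : ‖S.Ru‖ ≤ S.Psi := by simp [Psi]

theorem norm_Pinf_le_Gam (S : LQR n d) : ‖S.Pinf‖ ≤ S.Gam := le_max_right _ _

/-- The domination constant comes from `P_∞ ≤ Γ⋆ I` and `I ≤ β⋆ R_x`. -/
theorem isRiccatiSolution_Pinf (hn : 0 < n) (hRx : S.Rx.PosDef) (hRu : S.Ru.PosDef)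
    (hS : S.Stabilizable) : S.IsRiccatiSolution S.Pinf (S.beta * S.Gam) where
  Rx_posDef := hRx
  Ru_posDef := hRu
  posSemidef := (Pinf_spec hRx hRu hS).1
  ricc_eq := (Pinf_spec hRx hRu hS).2
  one_le := one_le_mul_of_one_le_of_one_le S.one_le_beta S.one_le_Gam
  sqNorm_le x := by
    have h1 : x ⬝ᵥ x ≤ S.beta * sqNorm S.Rx x := by
      have h := lambdaMin_mul_dotProduct_le hRx x
      have hpos := lambdaMin_pos hn hRx
      calc x ⬝ᵥ x ≤ (lambdaMin S.Rx)⁻¹ * sqNorm S.Rx x := by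
            rw [inv_mul_eq_div, le_div_iff₀ hpos]
            linarith
        _ ≤ S.beta * sqNorm S.Rx x := by
            gcongr
            · exact hRx.posSemidef.sqNorm_nonneg x
            · exact (le_max_right _ _).trans (le_max_right _ _)
    have h2 := sqNorm_le_norm S.Pinf x
    rw [← dotProduct_self_eq_norm_sq] at h2
    have h3 := S.norm_Pinf_le_Gam
    have h4 : 0 ≤ x ⬝ᵥ x := by
      rw [dotProduct_self_eq_norm_sq]
      positivity
    have h5 := S.one_le_Gam
    calc sqNorm S.Pinf x ≤ ‖S.Pinf‖ * (x ⬝ᵥ x) := h2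
      _ ≤ S.Gam * (S.beta * sqNorm S.Rx x) := by gcongr
      _ = S.beta * S.Gam * sqNorm S.Rx x := by ring

theorem sqrt_Pinf_mul_self (hP : S.Pinf.PosSemidef) :
    CFC.sqrt S.Pinf * CFC.sqrt S.Pinf = S.Pinf :=
  CFC.sqrt_mul_sqrt_self S.Pinf (by rwa [Matrix.nonneg_iff_posSemidef])

theorem sqrt_Pinf_transpose : (CFC.sqrt S.Pinf)ᵀ = CFC.sqrt S.Pinf :=
  (Matrix.nonneg_iff_posSemidef.1 (CFC.sqrt_nonneg S.Pinf)).transpose_eq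

theorem isUnit_det_sqrt_Pinf (hRx : S.Rx.PosDef) (hRu : S.Ru.PosDef) (hS : S.Stabilizable) :
    IsUnit (CFC.sqrt S.Pinf).det := by
  obtain ⟨hP, hfix⟩ := Pinf_spec hRx hRu hS
  have hPos : S.Pinf.PosDef := by
    have h : (S.Pinf - S.Rx).PosSemidef := by
      refine posSemidef_of_sqNorm_nonneg ?_ fun x => ?_
      · rw [Matrix.transpose_sub, hP.transpose_eq, hRx.posSemidef.transpose_eq]
      · have h := sqNorm_Rx_le_ricc (S := S) hRu hP x
        rw [hfix] at h
        rw [sqNorm_matrix_sub]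
        linarith
    simpa using hRx.add_posSemidef h
  have h := hPos.det_pos
  rw [← sqrt_Pinf_mul_self hP, Matrix.det_mul] at h
  exact (left_ne_zero_of_mul h.ne').isUnit

theorem one_le_kappaInf (hn : 0 < n) (hRx : S.Rx.PosDef) (hRu : S.Ru.PosDef)
    (hS : S.Stabilizable) : 1 ≤ S.kappaInf := by
  have : Nonempty (Fin n) := ⟨⟨0, hn⟩⟩
  have h := norm_mul_le (CFC.sqrt S.Pinf) (CFC.sqrt S.Pinf)⁻¹
  rwa [Matrix.mul_nonsing_inv _ (isUnit_det_sqrt_Pinf hRx hRu hS), norm_one] at h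

/-- With `y = P_∞^{1/2} x`, the Riccati equation bounds the left side squared by `‖x‖²_P -
‖x‖²_{R_x}`, the form of `I - P_∞^{-1/2} R_x P_∞^{-1/2}` at `y`. The lookahead is tuned to this rate
rather than to `rate b`. -/
theorem wNorm_closed_Pinf_le (hRx : S.Rx.PosDef) (hRu : S.Ru.PosDef) (hS : S.Stabilizable)
    (x : Fin n → ℝ) :
    wNorm S.Pinf (S.closed S.Pinf *ᵥ x) ≤ S.gammaInf * wNorm S.Pinf x := by
  obtain ⟨hP, hfix⟩ := Pinf_spec hRx hRu hS
  have hγ : S.gammaInf ^ 2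
      = ‖1 - (CFC.sqrt S.Pinf)⁻¹ * S.Rx * (CFC.sqrt S.Pinf)⁻¹‖ := Real.sq_sqrt (norm_nonneg _)
  refine wNorm_le_mul (c := S.gammaInf) (Real.sqrt_nonneg _) ?_
  rw [hγ]
  set H := CFC.sqrt S.Pinf with hH
  have hHH : Hᵀ * 1 * H = S.Pinf := by
    rw [mul_one, sqrt_Pinf_transpose, sqrt_Pinf_mul_self hP]
  have hinv : H⁻¹ *ᵥ H *ᵥ x = x := by
    rw [Matrix.mulVec_mulVec, Matrix.nonsing_inv_mul _ (isUnit_det_sqrt_Pinf hRx hRu hS),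
      Matrix.one_mulVec]
  have hinvT : (H⁻¹)ᵀ = H⁻¹ := by
    rw [Matrix.transpose_nonsing_inv, sqrt_Pinf_transpose]
  have h1 := sqNorm_le_norm (1 - H⁻¹ * S.Rx * H⁻¹) (H *ᵥ x)
  have h2 : sqNorm (H⁻¹ * S.Rx * H⁻¹) (H *ᵥ x) = sqNorm S.Rx x := by
    have h := sqNorm_congr S.Rx H⁻¹ (H *ᵥ x)
    rwa [hinvT, hinv] at h
  have h3 : sqNorm 1 (H *ᵥ x) = sqNorm S.Pinf x := by rw [← sqNorm_congr, hHH]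
  have h4 : ‖WithLp.toLp 2 (H *ᵥ x)‖ ^ 2 = sqNorm S.Pinf x := by
    rw [← h3, ← dotProduct_self_eq_norm_sq, sqNorm, Matrix.one_mulVec]
  rw [sqNorm_matrix_sub, h2, h3, h4] at h1
  have h5 := cost_add_sqNorm_closed hRu hP x
  rw [hfix] at h5
  linarith [hRu.posSemidef.sqNorm_nonneg (S.gain S.Pinf *ᵥ x)]

/-- Use `γ ≤ exp(-(1 - γ))`. However `h` is rounded, `h + 1` exceeds the real lookahead, so the
exponent `(h + 1)(1 - γ)` is at least `log T`. -/
theorem gammaInf_pow_le (hκ : 1 ≤ S.kappaInf) (hγ : S.gammaInf < 1) {T h : ℕ} (hT : 1 ≤ T)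
    (hh : |(h : ℝ) - S.lookahead T| < 1) : S.gammaInf ^ (h + 1) ≤ (T : ℝ)⁻¹ := by
  have hT' : (1 : ℝ) ≤ T := by exact_mod_cast hT
  have hγ0 : 0 ≤ S.gammaInf := Real.sqrt_nonneg _
  have hβ := S.one_le_beta
  have hΨ := S.one_le_Psi
  have hΓ := S.one_le_Gam
  set Z := S.kappaInf ^ 2 * S.beta ^ 2 * S.Psi * S.Gam ^ 2 * (T : ℝ) ^ 2 with hZ
  have hTZ : (T : ℝ) ≤ Z := by
    have h1 : 1 ≤ S.kappaInf ^ 2 * S.beta ^ 2 * S.Psi * S.Gam ^ 2 :=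
      one_le_mul_of_one_le_of_one_le (one_le_mul_of_one_le_of_one_le
        (one_le_mul_of_one_le_of_one_le (one_le_pow₀ hκ) (one_le_pow₀ hβ)) hΨ) (one_le_pow₀ hΓ)
    nlinarith
  have hlog : Real.log T ≤ Real.log Z := Real.log_le_log (by linarith) hTZ
  have hlog0 : 0 ≤ Real.log T := Real.log_nonneg hT'
  have hlook : (1 - S.gammaInf) * S.lookahead T = 2 * Real.log Z := by
    have : 1 - S.gammaInf ≠ 0 := by linarith
    rw [lookahead, ← hZ]
    field_simp
  have h1 : S.gammaInf ≤ Real.exp (-(1 - S.gammaInf)) := by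
    have := Real.add_one_le_exp (-(1 - S.gammaInf))
    linarith
  calc S.gammaInf ^ (h + 1) ≤ Real.exp (-(1 - S.gammaInf)) ^ (h + 1) := by gcongr
    _ = Real.exp (((h + 1 : ℕ) : ℝ) * -(1 - S.gammaInf)) := (Real.exp_nat_mul _ _).symm
    _ ≤ Real.exp (-Real.log T) := by
        gcongr
        push_cast
        have := (abs_lt.1 hh).1
        nlinarith
    _ = (T : ℝ)⁻¹ := by rw [Real.exp_neg, Real.exp_log (by linarith)]

theorem norm_dapBias_le {m T : ℕ} {R γ : ℝ} (hR : 0 ≤ R) (hγ0 : 0 ≤ γ) (hγ : γ < 1)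
    {M : Fin m → Matrix (Fin d) (Fin n) ℝ} (hM : M ∈ dapSet n d m R γ) {w : ℕ → Fin n → ℝ}
    (hw : IsDisturbance T w) (t : ℕ) :
    ‖WithLp.toLp 2 (dapBias M w t)‖ ≤ R * (1 - γ)⁻¹ := by
  have h1 : WithLp.toLp 2 (dapBias M w t)
      = ∑ i : Fin m, WithLp.toLp 2 (M i *ᵥ w (t - (i.val + 1))) := by
    rw [dapBias, WithLp.toLp_sum]
  rw [h1]
  calc _ ≤ ∑ i : Fin m, ‖WithLp.toLp 2 (M i *ᵥ w (t - (i.val + 1)))‖ := norm_sum_le _ _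
    _ ≤ ∑ i : Fin m, R * γ ^ i.val := by
        refine Finset.sum_le_sum fun i _ => ?_
        refine (norm_toLp_mulVec_le _ _).trans ?_
        exact (mul_le_of_le_one_right (norm_nonneg _) (hw.1 _)).trans (hM i)
    _ = R * ∑ i ∈ Finset.range m, γ ^ i := by
        rw [← Finset.mul_sum, Fin.sum_univ_eq_sum_range]
    _ ≤ R * (1 - γ)⁻¹ := by
        gcongr
        rw [← tsum_geometric_of_lt_one hγ0 hγ]
        exact (summable_geometric_of_lt_one hγ0 hγ).sum_le_tsum _ fun i _ => pow_nonneg hγ0 i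

theorem sqNorm_hess_Pinf_le (u : Fin d → ℝ) :
    sqNorm (S.hess S.Pinf) u ≤ 2 * S.Psi ^ 2 * S.Gam * ‖WithLp.toLp 2 u‖ ^ 2 := by
  have hΨ := S.one_le_Psi
  have hΓ := S.one_le_Gam
  have h1 := sqNorm_le_norm S.Ru u
  have h2 := sqNorm_le_norm S.Pinf (S.B *ᵥ u)
  have h3 := norm_toLp_mulVec_le S.B u
  have h4 : ‖S.Pinf‖ * ‖WithLp.toLp 2 (S.B *ᵥ u)‖ ^ 2
      ≤ S.Gam * (S.Psi * ‖WithLp.toLp 2 u‖) ^ 2 := by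
    gcongr
    · exact S.norm_Pinf_le_Gam
    · exact h3.trans (by gcongr; exact S.norm_B_le_Psi)
  have h5 : ‖S.Ru‖ * ‖WithLp.toLp 2 u‖ ^ 2 ≤ S.Psi ^ 2 * S.Gam * ‖WithLp.toLp 2 u‖ ^ 2 := by
    gcongr
    exact S.norm_Ru_le_Psi.trans (by nlinarith)
  rw [sqNorm_hess]
  linarith

end LQR

/-! ### The final bound. -/

theorem theorem2 :
    ∃ (C : ℝ) (k : ℕ), 0 < C ∧
      ∀ (n d : ℕ) (S : LQR n d), S.Rx.PosDef → S.Ru.PosDef → S.Stabilizable →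
      ∀ (κ₀ γ₀ : ℝ), S.kappaInf ≤ κ₀ → S.gammaInf ≤ γ₀ → γ₀ < 1 →
      ∀ (T m h : ℕ), 2 ≤ T → |(m : ℝ) - dapMemory γ₀ T| < 1 → |(h : ℝ) - S.lookahead T| < 1 →
      ∀ (M : ℕ → (ℕ → Fin n → ℝ) → Fin m → Matrix (Fin d) (Fin n) ℝ) (w : ℕ → Fin n → ℝ),
        IsDisturbance T w →
        (∀ t ∈ Finset.Icc 1 T, M t w ∈ dapSet n d m (S.Rstar κ₀) γ₀) →
        ∑ t ∈ Finset.Icc 1 T,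
            |S.advantage T w t (S.input (S.dapPolicy M) w t) (S.state (S.dapPolicy M) w t)
              - S.approxAdvantage h (M t w) w t|
          ≤ C * (S.beta ^ 11 * S.Psi ^ 19 * S.Gam ^ 11 * κ₀ ^ 8 * ((1 - γ₀)⁻¹) ^ 4)
              * Real.log (2 + S.beta * S.Psi * S.Gam * κ₀ * (1 - γ₀)⁻¹) ^ k
              * Real.log T ^ 2 := by
  have hlog2 : 0 < Real.log 2 := Real.log_pos (by norm_num)
  -- Here `32688 = 4086·8`, and `log 2 ≤ log T` pays for the factor `log² T`; no parameter logarithm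
  -- is needed.
  refine ⟨32688 / Real.log 2 ^ 2, 0, by positivity, ?_⟩
  intro n d S hRx hRu hS κ₀ γ₀ hκ hγ hγ1 T m h hT _ hh M w hw hM
  have hβ := S.one_le_beta
  have hΨ := S.one_le_Psi
  have hΓ := S.one_le_Gam
  have hγ0 : 0 ≤ γ₀ := (Real.sqrt_nonneg _).trans hγ
  have hr : 1 ≤ (1 - γ₀)⁻¹ := (one_le_inv₀ (by linarith)).2 (by linarith)
  rw [pow_zero, mul_one]
  -- In state dimension zero `κ_∞ ≥ 1` fails, but all biases and inputs vanish, and with them both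
  -- advantages.
  rcases Nat.eq_zero_or_pos n with rfl | hn
  · refine le_trans (le_of_eq (Finset.sum_eq_zero fun t ht => ?_)) (by positivity)
    have hsub : ∀ (k : ℕ) (N : Matrix (Fin k) (Fin 0) ℝ) (x : Fin 0 → ℝ), N *ᵥ x = 0 :=
      fun k N x => by rw [Subsingleton.elim x 0, Matrix.mulVec_zero]
    have hbias : dapBias (M t w) w t = 0 := Finset.sum_eq_zero fun i _ => hsub d _ _
    have hqInf : S.qInf h w t = 0 := Finset.sum_eq_zero fun i _ => hsub d _ _
    have hin : S.input (S.dapPolicy M) w t = 0 := by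
      rw [LQR.input, LQR.dapPolicy, hsub, hbias, neg_zero, sub_zero]
    have hadv : S.advantage T w t (S.input (S.dapPolicy M) w t) (S.state (S.dapPolicy M) w t)
        = 0 := by
      rcases (Finset.mem_Icc.1 ht).2.lt_or_eq with hlt | rfl
      · have hoff : ∀ k, S.offset T w k = 0 := fun k => by
          rw [LQR.offset, hsub d S.Bᵀ, Matrix.mulVec_zero]
        rw [LQR.advantage_eq hRx hRu hlt, hin, hoff, hsub, add_zero, add_zero, sqNorm_zero]
      · rw [LQR.advantage_final hRu, hin, sqNorm_zero]
    rw [hadv, LQR.approxAdvantage, hbias, hqInf, sub_zero, sqNorm_zero, sub_zero, abs_zero]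
  have hκ1 : 1 ≤ S.kappaInf := LQR.one_le_kappaInf hn hRx hRu hS
  have hκ0 : 1 ≤ κ₀ := hκ1.trans hκ
  have hω : ∀ t, wNorm S.Pinf (w t) ≤ √S.Gam := fun t => by
    refine Real.sqrt_le_sqrt ((sqNorm_le_norm _ _).trans ?_)
    have h1 : ‖WithLp.toLp 2 (w t)‖ ^ 2 ≤ 1 := pow_le_one₀ (norm_nonneg _) (hw.1 t)
    exact (mul_le_of_le_one_right (norm_nonneg _) h1).trans S.norm_Pinf_le_Gam
  -- The square of the radius `c`: `Σ_∞ ≤ 2Ψ⋆²Γ⋆ I`, and the bias has norm at most `R⋆/(1 - γ₀)` by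
  -- a geometric series, uniformly in the memory.
  set c2 := 2 * S.Psi ^ 2 * S.Gam * (S.Rstar κ₀ * (1 - γ₀)⁻¹) ^ 2 with hc2
  have hR1 : 1 ≤ S.Rstar κ₀ := by
    have h1 : 1 ≤ S.beta * S.Psi ^ 2 * S.Gam * κ₀ ^ 2 :=
      one_le_mul_of_one_le_of_one_le (one_le_mul_of_one_le_of_one_le
        (one_le_mul_of_one_le_of_one_le hβ (one_le_pow₀ hΨ)) hΓ) (one_le_pow₀ hκ0)
    rw [LQR.Rstar]
    linarith
  have hωc : √S.Gam ≤ √c2 := by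
    refine Real.sqrt_le_sqrt ?_
    have h1 : 1 ≤ (S.Rstar κ₀ * (1 - γ₀)⁻¹) ^ 2 :=
      one_le_pow₀ (one_le_mul_of_one_le_of_one_le hR1 hr)
    have h2 : S.Gam ≤ 2 * S.Psi ^ 2 * S.Gam := by
      nlinarith [one_le_pow₀ hΨ (n := 2)]
    exact h2.trans (le_mul_of_one_le_right (by positivity) h1)
  have hq : ∀ t ∈ Finset.Icc 1 T, wNorm (S.hess S.Pinf) (dapBias (M t w) w t) ≤ √c2 := by
    intro t ht
    refine Real.sqrt_le_sqrt ((LQR.sqNorm_hess_Pinf_le _).trans ?_)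
    have := LQR.norm_dapBias_le (by linarith) hγ0 hγ1 (hM t ht) hw t
    rw [hc2]
    gcongr
  have hsum := (LQR.isRiccatiSolution_Pinf hn hRx hRu hS).sum_abs_advantage_sub_le
    (Real.sqrt_nonneg _) hω (Real.sqrt_nonneg _) (LQR.wNorm_closed_Pinf_le hRx hRu hS)
    (by omega) (LQR.gammaInf_pow_le hκ1 (hγ.trans_lt hγ1) (by omega) hh) hωc hq
  refine hsum.trans ?_
  rw [Real.sq_sqrt (by positivity), hc2, LQR.Rstar]
  have hlogT : Real.log 2 ≤ Real.log T :=
    Real.log_le_log (by norm_num) (by exact_mod_cast hT)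
  have hlogT2 : 1 ≤ Real.log T ^ 2 / Real.log 2 ^ 2 := by
    rw [one_le_div (by positivity)]
    gcongr
  calc 4086 * (S.beta * S.Gam) ^ 8 * (2 * S.Psi ^ 2 * S.Gam
        * (2 * S.beta * S.Psi ^ 2 * S.Gam * κ₀ ^ 2 * (1 - γ₀)⁻¹) ^ 2)
      = 32688 * (S.beta ^ 10 * S.Psi ^ 6 * S.Gam ^ 11 * κ₀ ^ 4 * ((1 - γ₀)⁻¹) ^ 2) := by ring
    -- The powers obtained are smaller than the stated ones; every base is at least one.
    _ ≤ 32688 * (S.beta ^ 11 * S.Psi ^ 19 * S.Gam ^ 11 * κ₀ ^ 8 * ((1 - γ₀)⁻¹) ^ 4) := by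
        gcongr <;> first | assumption | norm_num
    _ ≤ 32688 * (S.beta ^ 11 * S.Psi ^ 19 * S.Gam ^ 11 * κ₀ ^ 8 * ((1 - γ₀)⁻¹) ^ 4)
          * (Real.log T ^ 2 / Real.log 2 ^ 2) :=
        le_mul_of_one_le_right (by positivity) hlogT2
    _ = _ := by ring
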